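/- Let $A$ be a connected Nakayama algebra, that is, a nonzero Artin algebra (a finitely generated algebra over a commutative artinian ring) with no central idempotents other than $0$ and $1$, all of whose finitely generated indecomposable projective and indecomposable injective modules are uniserial. For a simple $A$-module $S$ let $P(S)$ be its projective cover, $I(S)$ its injective envelope and $\operatorname{pd} S$ its projective dimension. For simple modules put $\tilde\tau(S)=\tau(S)=D\operatorname{Tr}(S)$ (the Auslander--Reiten translate) if $S$ is not projective, and $\tilde\tau(S)=S_{\mathrm{inj}}$, the unique simple injective $A$-module up to isomorphism, if $S$ is projective. Let $$\gamma(S)=\tilde\tau(\operatorname{soc} P(S)),\qquad \psi(S)=\tilde\tau^{-1}(\operatorname{top} I(S)),$$ where $\operatorname{soc}$ is the socle and $\operatorname{top} M=M/\operatorname{rad} M$. These are well-defined maps from the set of isomorphism classes of simple $A$-modules to itself. The resolution quiver of $A$ has the isomorphism classes of simple $A$-modules as vertices and exactly one arrow $S\to\gamma(S)$ starting at each vertex $S$; a $\psi$-cycle is a cycle in the quiver defined in the same way by the arrows $S\to\psi(S)$. A simple module $S$ is $\psi$-cyclic if $\psi^m(S)=S$ for some integer $m>0$. A cycle in the resolution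 quiver is black if no vertex $S$ on it has $\operatorname{pd} S=1$. Let $C$ be a cycle in the resolution quiver of $A$. Then the following statements are equivalent. 1. The vertices of $C$ form a $\psi$-cycle, i.e. there is a $\psi$-cycle whose set of vertices is the set of vertices of $C$. 2. Each vertex of $C$ is $\psi$-cyclic. 3. $C$ is a black cycle. -/

import Mathlib

universe u

namespace NakayamaResolution

section Modules

variable (A : Type u) [Ring A]

/-- A module is uniserial if its submodules form a chain. -/
def IsUniserial (M : Type u) [AddCommGroup M] [Module A M] : Prop :=
  ∀ N N' : Submodule A M, N ≤ N' ∨ N' ≤ N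

/-- A module is indecomposable if it is nonzero and has no proper direct sum decomposition. -/
def IsIndecomposable (M : Type u) [AddCommGroup M] [Module A M] : Prop :=
  Nontrivial M ∧ ∀ N N' : Submodule A M, IsCompl N N' → N = ⊥ ∨ N' = ⊥

/-- The socle: the sum of all simple submodules. -/
def socle (M : Type u) [AddCommGroup M] [Module A M] : Submodule A M :=
  sSup {N : Submodule A M | IsSimpleModule A N}

/-- The top of a module: the quotient by its radical (`Module.jacobson` is the intersection of
all maximal submodules). -/
abbrev Top (M : Type u) [AddCommGroup M] [Module A M] : Type u :=
  M ⧸ Module.jacobson A M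

variable {A}

/-- `p : P → M` is a projective cover: `P` is projective and `p` is surjective with superfluous
kernel. -/
def IsProjectiveCover {P M : Type u} [AddCommGroup P] [Module A P] [AddCommGroup M] [Module A M]
    (p : P →ₗ[A] M) : Prop :=
  Module.Projective A P ∧ Function.Surjective p ∧
    ∀ N : Submodule A P, N ⊔ LinearMap.ker p = ⊤ → N = ⊤

/-- `i : M → I` is an injective envelope: `I` is injective and `i` is injective with essential
image. -/
def IsInjectiveEnvelope {M I : Type u} [AddCommGroup M] [Module A M] [AddCommGroup I] [Module A I]
    (i : M →ₗ[A] I) : Prop :=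
  Module.Injective A I ∧ Function.Injective i ∧
    ∀ N : Submodule A I, N ⊓ LinearMap.range i = ⊥ → N = ⊥

/-- `P₁ → P₀ → M → 0` is a minimal projective presentation: `p` is a projective cover of `M`, and
`f` maps `P₁` onto `ker p` and is a projective cover of it. -/
def IsMinimalProjectivePresentation {P₁ P₀ M : Type u} [AddCommGroup P₁] [Module A P₁]
    [AddCommGroup P₀] [Module A P₀] [AddCommGroup M] [Module A M]
    (f : P₁ →ₗ[A] P₀) (p : P₀ →ₗ[A] M) : Prop :=
  IsProjectiveCover p ∧ LinearMap.range f = LinearMap.ker p ∧ IsProjectiveCover f.rangeRestrict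

/-- The map `Hom_A(f, A) : Hom_A(P₀, A) → Hom_A(P₁, A)` of right `A`-modules. -/
def dualMap {P₁ P₀ : Type u} [AddCommGroup P₁] [Module A P₁] [AddCommGroup P₀] [Module A P₀]
    (f : P₁ →ₗ[A] P₀) : (P₀ →ₗ[A] A) →ₗ[Aᵐᵒᵖ] (P₁ →ₗ[A] A) where
  toFun φ := φ.comp f
  map_add' _ _ := rfl
  map_smul' _ _ := rfl

/-- The transpose (a right `A`-module) computed from a projective presentation `f : P₁ → P₀`: the
cokernel of `Hom_A(f, A)`. -/
abbrev Transpose {P₁ P₀ : Type u} [AddCommGroup P₁] [Module A P₁] [AddCommGroup P₀] [Module A P₀]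
    (f : P₁ →ₗ[A] P₀) : Type u :=
  (P₁ →ₗ[A] A) ⧸ LinearMap.range (dualMap f)

end Modules

section Artin

variable (R : Type u) {A : Type u} [CommRing R] [Ring A] [Algebra R A]

/-- The left `A`-module `Y` is isomorphic to the usual dual `D X = Hom_R(X, J)` of the right
`A`-module `X`, where `J` is an injective envelope of `R / rad R` over `R`. The left action on
`Hom_R(X, J)` is `(a • φ) x = φ (x a)`. -/
def IsDual (X : Type u) [AddCommGroup X] [Module R X] [Module Aᵐᵒᵖ X] [IsScalarTower R Aᵐᵒᵖ X]
    (Y : Type u) [AddCommGroup Y] [Module A Y] : Prop :=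
  ∃ (J : ModuleCat.{u} R) (i : (R ⧸ Ring.jacobson R) →ₗ[R] J), IsInjectiveEnvelope i ∧
    ∃ e : Y ≃+ (X →ₗ[R] J), ∀ (a : A) (y : Y) (x : X), e (a • y) x = e y (MulOpposite.op a • x)

/-- `Y ≅ τ X = D Tr X` (Auslander-Reiten translation). -/
def IsARTranslate (X Y : Type u) [AddCommGroup X] [Module A X] [AddCommGroup Y] [Module A Y] :
    Prop :=
  ∃ (P₁ P₀ : ModuleCat.{u} A) (f : P₁ →ₗ[A] P₀) (p : P₀ →ₗ[A] X),
    IsMinimalProjectivePresentation f p ∧ IsDual R (A := A) (Transpose f) Y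

/-- `Y ≅ τ̃ X`: the Auslander-Reiten translate of `X` if `X` is not projective, and the simple
injective module otherwise. -/
def IsTauTilde (X Y : Type u) [AddCommGroup X] [Module A X] [AddCommGroup Y] [Module A Y] : Prop :=
  (¬ Module.Projective A X ∧ IsARTranslate R (A := A) X Y) ∨
    (Module.Projective A X ∧ IsSimpleModule A Y ∧ Module.Injective A Y)

end Artin

/-- `A` is a connected Nakayama algebra: an Artin algebra over the commutative artinian ring `R`,
nonzero and without nontrivial central idempotents, all of whose finitely generated indecomposable
projective modules and finitely generated indecomposable injective modules are uniserial. -/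
structure IsConnectedNakayama (R A : Type u) [CommRing R] [Ring A] [Algebra R A] : Prop where
  artinian : IsArtinianRing R
  finite : Module.Finite R A
  nontrivial : Nontrivial A
  connected : ∀ e : A, IsIdempotentElem e → (∀ a : A, e * a = a * e) → e = 0 ∨ e = 1
  projective_uniserial : ∀ (P : Type u) [AddCommGroup P] [Module A P],
    Module.Finite A P → Module.Projective A P → IsIndecomposable A P → IsUniserial A P
  injective_uniserial : ∀ (I : Type u) [AddCommGroup I] [Module A I],
    Module.Finite A I → Module.Injective A I → IsIndecomposable A I → IsUniserial A I

section Simples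

variable (A : Type u) [Ring A]

/-- Isomorphism of simple modules. -/
instance simpleSetoid : Setoid {M : ModuleCat.{u} A // IsSimpleModule A M} where
  r M N := Nonempty (M.1 ≃ₗ[A] N.1)
  iseqv := ⟨fun _ => ⟨LinearEquiv.refl A _⟩, fun ⟨e⟩ => ⟨e.symm⟩, fun ⟨e⟩ ⟨f⟩ => ⟨e.trans f⟩⟩

/-- The set of isomorphism classes of simple `A`-modules. -/
def SimpleClass : Type (u + 1) := Quotient (simpleSetoid A)

variable {A}

/-- A simple module in the given isomorphism class. -/
noncomputable def SimpleClass.rep (S : SimpleClass A) : ModuleCat.{u} A :=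
  (Quotient.out S).1

end Simples

section Maps

variable (R : Type u) {A : Type u} [CommRing R] [Ring A] [Algebra R A]

/-- `T ≅ τ̃ (soc P(S))`. -/
def IsGamma (S T : SimpleClass A) : Prop :=
  ∃ (P : ModuleCat.{u} A) (p : P →ₗ[A] S.rep), IsProjectiveCover p ∧
    IsTauTilde R (A := A) (socle A P) T.rep

/-- `T ≅ τ̃⁻¹ (top I(S))`, that is, `τ̃ T ≅ top I(S)`. -/
def IsPsi (S T : SimpleClass A) : Prop :=
  ∃ (I : ModuleCat.{u} A) (i : S.rep →ₗ[A] I), IsInjectiveEnvelope i ∧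
    IsTauTilde R (A := A) T.rep (Top A I)

/-- The map `γ`: `γ S` is the class `T` with `IsGamma R S T`. -/
noncomputable def gamma (S : SimpleClass A) : SimpleClass A :=
  @Classical.epsilon _ ⟨S⟩ (IsGamma R S)

/-- The map `ψ`: `ψ S` is the class `T` with `IsPsi R S T`. -/
noncomputable def psi (S : SimpleClass A) : SimpleClass A :=
  @Classical.epsilon _ ⟨S⟩ (IsPsi R S)

end Maps

/-- `C` is a cycle of the self-map `f`, i.e. an oriented cycle in the quiver with exactly one arrow
`x → f x` for each vertex `x`. For `f = γ` this quiver is the resolution quiver. -/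
def IsCycleOf {α : Type*} (f : α → α) (C : Cycle α) : Prop :=
  C ≠ Cycle.nil ∧ C.Nodup ∧ C.Chain fun x y => f x = y

/-- `S` is `γ`-black: its projective dimension is not `1`. -/
def IsBlack {A : Type u} [Ring A] (S : SimpleClass A) : Prop :=
  CategoryTheory.projectiveDimension S.rep ≠ 1

end NakayamaResolution

/-! Over a Nakayama algebra the composition factors of a uniserial module follow one another by a
fixed rule: the factor just below a simple module `S` is the top of rad P(S), which is the unique
`U` admitting a nonsplit extension 0 → U → Z → S → 0, and it is also `τ S`. Dually, `U` determines
`S` through I(U)/U. Thus on simple modules `τ̃` is "next factor down", closed up by sending the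
projective simple, if there is one, to the injective simple. Connectedness makes these two unique
and finiteness makes them exist together, so `τ̃` is a bijection and `γ`, `ψ` are well defined.

Two facts then decide the theorem.

(a) The image of `ψ` is black (`isBlack_of_isPsi`). Let S = ψ(T) be nonprojective, so that rad P(S)
and I(T) have the same top. If rad P(S) were projective it would map onto I(T). By injectivity that
map extends to P(S), and its kernel lies in rad P(S). But the image is already attained on rad P(S),
which is impossible.

(b) If `S` is black, then ψ(γ(S)) = S (`isPsi_of_isBlack`). For nonprojective `S` put K = rad P(S),
let P₁ → K be a projective cover with nonzero kernel X, and let V be the top of X. Then V lies just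
below soc K in P₁, so V = γ(S). The module Y = P₁/rad X has socle V and top `τ S`. If Y were not all
of I(V), the next factor above it would be `S`, so K would map onto Y, which maps onto K with
nonzero kernel, contradicting finite length. Hence I(V) has top `τ S`, that is, ψ(V) = S.

A `ψ`-cyclic vertex lies in the image of `ψ`, so it is black by (a). On a black cycle `ψ` inverts
`γ` by (b), so the reversed cycle is a `ψ`-cycle.

The link between the definition D Tr and extensions is `equiv_of_isDual`: the transpose of `S` is
Hom(P₁, A) modulo the maps into rad A. This is a simple right module whose dual is the top of P₁. -/

namespace NakayamaResolution

/-! ### Uniserial modules, their tops and socles -/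

section Uniserial

variable {A : Type u} [Ring A]
variable {M N P Q S U V : Type u} [AddCommGroup M] [Module A M] [AddCommGroup N] [Module A N]
  [AddCommGroup P] [Module A P] [AddCommGroup Q] [Module A Q] [AddCommGroup S] [Module A S]
  [AddCommGroup U] [Module A U] [AddCommGroup V] [Module A V]

theorem IsUniserial.of_injective (hM : IsUniserial A M) (f : N →ₗ[A] M)
    (hf : Function.Injective f) : IsUniserial A N := by
  intro K L
  rcases hM (K.map f) (L.map f) with h | h
  · exact Or.inl ((Submodule.map_le_map_iff_of_injective hf _ _).1 h)
  · exact Or.inr ((Submodule.map_le_map_iff_of_injective hf _ _).1 h)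

theorem IsUniserial.of_surjective (hM : IsUniserial A M) (f : M →ₗ[A] N)
    (hf : Function.Surjective f) : IsUniserial A N := by
  intro K L
  rcases hM (K.comap f) (L.comap f) with h | h
  · exact Or.inl ((Submodule.comap_le_comap_iff_of_surjective hf).1 h)
  · exact Or.inr ((Submodule.comap_le_comap_iff_of_surjective hf).1 h)

theorem isCoatom_ker_of_surjective [IsSimpleModule A S] (p : M →ₗ[A] S)
    (hp : Function.Surjective p) : IsCoatom (LinearMap.ker p) :=
  isSimpleModule_iff_isCoatom.1
    (IsSimpleModule.congr (LinearMap.quotKerEquivOfSurjective p hp))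

theorem isAtom_range_of_injective [IsSimpleModule A S] (i : S →ₗ[A] M)
    (hi : Function.Injective i) : IsAtom (LinearMap.range i) :=
  isSimpleModule_iff_isAtom.1 (IsSimpleModule.congr (LinearEquiv.ofInjective i hi).symm)

/-- In a chain of submodules a maximal submodule is the greatest proper one. This and its dual
`range_le` reduce surjectivity and injectivity to tests on the top and on the socle. -/
theorem IsUniserial.le_ker (hM : IsUniserial A M) [IsSimpleModule A S] {p : M →ₗ[A] S}
    (hp : Function.Surjective p) {K : Submodule A M} (hK : K ≠ ⊤) : K ≤ LinearMap.ker p := by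
  rcases hM K (LinearMap.ker p) with h | h
  · exact h
  · rcases h.eq_or_lt with h | h
    · exact h.ge
    · exact absurd ((isCoatom_ker_of_surjective p hp).2 _ h) hK

theorem IsUniserial.range_le (hM : IsUniserial A M) [IsSimpleModule A S] {i : S →ₗ[A] M}
    (hi : Function.Injective i) {K : Submodule A M} (hK : K ≠ ⊥) : LinearMap.range i ≤ K := by
  rcases hM K (LinearMap.range i) with h | h
  · rcases h.eq_or_lt with h | h
    · exact h.ge
    · exact absurd ((isAtom_range_of_injective i hi).2 _ h) hK
  · exact h

/-- A map onto a uniserial module can be tested for surjectivity on a simple quotient. -/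
theorem IsUniserial.surjective_of_comp_ne_zero (hM : IsUniserial A M) [IsSimpleModule A S]
    {p : M →ₗ[A] S} (hp : Function.Surjective p) {f : N →ₗ[A] M} (hf : p ∘ₗ f ≠ 0) :
    Function.Surjective f := by
  by_contra h
  rw [← LinearMap.range_eq_top] at h
  exact hf (LinearMap.range_le_ker_iff.1 (hM.le_ker hp h))

/-- A map out of a uniserial module can be tested for injectivity on a simple submodule. -/
theorem IsUniserial.injective_of_comp_ne_zero (hM : IsUniserial A M) [IsSimpleModule A S]
    {i : S →ₗ[A] M} (hi : Function.Injective i) {f : M →ₗ[A] N} (hf : f ∘ₗ i ≠ 0) :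
    Function.Injective f := by
  by_contra h
  rw [← LinearMap.ker_eq_bot] at h
  exact hf (LinearMap.range_le_ker_iff.1 (hM.range_le hi h))

theorem IsUniserial.equiv_of_quotients (hM : IsUniserial A M) [IsSimpleModule A S]
    [IsSimpleModule A U] {p : M →ₗ[A] S} (hp : Function.Surjective p) {q : M →ₗ[A] U}
    (hq : Function.Surjective q) : Nonempty (S ≃ₗ[A] U) := by
  have h : LinearMap.ker p = LinearMap.ker q :=
    le_antisymm (hM.le_ker hq (isCoatom_ker_of_surjective p hp).1)
      (hM.le_ker hp (isCoatom_ker_of_surjective q hq).1)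
  exact ⟨(LinearMap.quotKerEquivOfSurjective p hp).symm ≪≫ₗ Submodule.quotEquivOfEq _ _ h ≪≫ₗ
    LinearMap.quotKerEquivOfSurjective q hq⟩

theorem IsUniserial.equiv_of_submodules (hM : IsUniserial A M) [IsSimpleModule A S]
    [IsSimpleModule A U] {i : S →ₗ[A] M} (hi : Function.Injective i) {j : U →ₗ[A] M}
    (hj : Function.Injective j) : Nonempty (S ≃ₗ[A] U) := by
  have h : LinearMap.range i = LinearMap.range j :=
    le_antisymm (hM.range_le hi (isAtom_range_of_injective j hj).1)
      (hM.range_le hj (isAtom_range_of_injective i hi).1)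
  exact ⟨LinearEquiv.ofInjective i hi ≪≫ₗ LinearEquiv.ofEq _ _ h ≪≫ₗ
    (LinearEquiv.ofInjective j hj).symm⟩

theorem IsUniserial.jacobson_eq (hM : IsUniserial A M) {K : Submodule A M} (hK : IsCoatom K) :
    Module.jacobson A M = K := by
  refine le_antisymm (sInf_le hK) (le_sInf fun L hL => ?_)
  rcases hM K L with h | h
  · exact h
  · exact ((hL.le_iff.1 h).resolve_left hK.1).le

theorem IsUniserial.socle_eq (hM : IsUniserial A M) {K : Submodule A M} (hK : IsAtom K) :
    socle A M = K := by
  refine le_antisymm (sSup_le fun L hL => ?_) (le_sSup (isSimpleModule_iff_isAtom.2 hK))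
  have hL' : IsAtom L := isSimpleModule_iff_isAtom.1 hL
  rcases hM L K with h | h
  · exact h
  · exact ((hL'.le_iff.1 h).resolve_left hK.1).ge

theorem IsUniserial.isSimpleModule_top (hM : IsUniserial A M) [Module.Finite A M] [Nontrivial M] :
    IsSimpleModule A (Top A M) := by
  obtain ⟨K, hK, -⟩ := (eq_top_or_exists_le_coatom (⊥ : Submodule A M)).resolve_left bot_ne_top
  exact isSimpleModule_iff_isCoatom.2 ((hM.jacobson_eq hK).symm ▸ hK)

theorem IsUniserial.isSimpleModule_socle (hM : IsUniserial A M) [IsArtinian A M] [Nontrivial M] :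
    IsSimpleModule A (socle A M) := by
  obtain ⟨K, hK, -⟩ := (eq_bot_or_exists_atom_le (⊤ : Submodule A M)).resolve_left top_ne_bot
  rw [hM.socle_eq hK]
  exact isSimpleModule_iff_isAtom.2 hK

theorem IsUniserial.isProjectiveCover (hM : IsUniserial A M) [Module.Projective A M]
    [IsSimpleModule A S] {p : M →ₗ[A] S} (hp : Function.Surjective p) : IsProjectiveCover p := by
  refine ⟨inferInstance, hp, fun K hK => by_contra fun h => ?_⟩
  rw [sup_eq_right.2 (hM.le_ker hp h)] at hK
  exact (isCoatom_ker_of_surjective p hp).1 hK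

theorem IsUniserial.isInjectiveEnvelope (hM : IsUniserial A M) [Module.Injective A M]
    [IsSimpleModule A S] {i : S →ₗ[A] M} (hi : Function.Injective i) : IsInjectiveEnvelope i := by
  refine ⟨inferInstance, hi, fun K hK => by_contra fun h => ?_⟩
  rw [inf_eq_right.2 (hM.range_le hi h)] at hK
  exact (isAtom_range_of_injective i hi).1 hK

theorem IsSimpleModule.isUniserial [IsSimpleModule A S] : IsUniserial A S := by
  intro K L
  rcases eq_bot_or_eq_top K with h | h <;> simp [h]

end Uniserial

/-! ### Uniqueness of projective covers and injective envelopes -/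

section Covers

variable {A : Type u} [Ring A]
variable {M P Q I J : Type u} [AddCommGroup M] [Module A M]
  [AddCommGroup P] [Module A P] [AddCommGroup Q] [Module A Q] [AddCommGroup I] [Module A I]
  [AddCommGroup J] [Module A J]

theorem IsProjectiveCover.surjective_of_comp {p : P →ₗ[A] M} (hp : IsProjectiveCover p)
    {f : Q →ₗ[A] P} (hf : Function.Surjective (p ∘ₗ f)) : Function.Surjective f := by
  rw [← LinearMap.range_eq_top]
  refine hp.2.2 _ (eq_top_iff.2 fun x _ => ?_)
  obtain ⟨y, hy⟩ := hf (p x)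
  refine Submodule.mem_sup.2 ⟨f y, ⟨y, rfl⟩, x - f y, ?_, by abel⟩
  rw [LinearMap.mem_ker, map_sub, sub_eq_zero]
  exact hy.symm

theorem IsInjectiveEnvelope.injective_of_comp {i : M →ₗ[A] I} (hi : IsInjectiveEnvelope i)
    {f : I →ₗ[A] J} (hf : Function.Injective (f ∘ₗ i)) : Function.Injective f := by
  rw [← LinearMap.ker_eq_bot]
  refine hi.2.2 _ (eq_bot_iff.2 ?_)
  rintro _ ⟨hx, y, rfl⟩
  have : y = 0 := hf (by simpa using hx)
  simp [this]

theorem Module.Injective.exists_extension [Module.Injective A J] (i : M →ₗ[A] I)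
    (hi : Function.Injective i) (f : M →ₗ[A] J) : ∃ h : I →ₗ[A] J, h ∘ₗ i = f := by
  obtain ⟨h, hh⟩ := Module.Injective.out i hi f
  exact ⟨h, LinearMap.ext hh⟩

/-- Two projective covers of a module are isomorphic. -/
theorem IsProjectiveCover.exists_equiv {p : P →ₗ[A] M} (hp : IsProjectiveCover p)
    {q : Q →ₗ[A] M} (hq : IsProjectiveCover q) : ∃ e : P ≃ₗ[A] Q, q ∘ₗ e.toLinearMap = p := by
  have := hp.1
  have := hq.1
  obtain ⟨f, hf⟩ := Module.projective_lifting_property q p hq.2.1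
  have hfs : Function.Surjective f := hq.surjective_of_comp (by rw [hf]; exact hp.2.1)
  obtain ⟨g, hg⟩ := Module.projective_lifting_property f LinearMap.id hfs
  have hgs : Function.Surjective g := by
    refine hp.surjective_of_comp ?_
    rw [← hf, LinearMap.comp_assoc, hg]
    exact hq.2.1
  have hfi : Function.Injective f := by
    intro x y hxy
    obtain ⟨x, rfl⟩ := hgs x
    obtain ⟨y, rfl⟩ := hgs y
    have h : ∀ z, f (g z) = z := fun z => LinearMap.congr_fun hg z
    rw [h, h] at hxy
    rw [hxy]
  exact ⟨LinearEquiv.ofBijective f ⟨hfi, hfs⟩, hf⟩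

/-- Two injective envelopes of a module are isomorphic. -/
theorem IsInjectiveEnvelope.exists_equiv {i : M →ₗ[A] I} (hi : IsInjectiveEnvelope i)
    {j : M →ₗ[A] J} (hj : IsInjectiveEnvelope j) :
    ∃ e : I ≃ₗ[A] J, e.toLinearMap ∘ₗ i = j := by
  have := hi.1
  have := hj.1
  obtain ⟨f, hf⟩ := Module.Injective.exists_extension i hi.2.1 j
  have hfi : Function.Injective f := hi.injective_of_comp (by rw [hf]; exact hj.2.1)
  obtain ⟨g, hg⟩ := Module.Injective.exists_extension f hfi LinearMap.id
  have hgi : Function.Injective g := by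
    refine hj.injective_of_comp ?_
    rw [← hf, ← LinearMap.comp_assoc, hg]
    exact hi.2.1
  have hfs : Function.Surjective f := fun y =>
    ⟨g y, hgi (LinearMap.congr_fun hg (g y))⟩
  exact ⟨LinearEquiv.ofBijective f ⟨hfi, hfs⟩, hf⟩

theorem IsProjectiveCover.comp_equiv {p : P →ₗ[A] M} (hp : IsProjectiveCover p)
    (e : M ≃ₗ[A] Q) : IsProjectiveCover (e.toLinearMap ∘ₗ p) := by
  refine ⟨hp.1, e.surjective.comp hp.2.1, fun N hN => hp.2.2 N ?_⟩
  rwa [LinearMap.ker_comp, LinearEquiv.ker, Submodule.comap_bot] at hN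

theorem IsInjectiveEnvelope.comp_equiv {i : M →ₗ[A] I} (hi : IsInjectiveEnvelope i)
    (e : Q ≃ₗ[A] M) : IsInjectiveEnvelope (i ∘ₗ e.toLinearMap) := by
  refine ⟨hi.1, hi.2.1.comp e.injective, fun N hN => hi.2.2 N ?_⟩
  rwa [LinearMap.range_comp, LinearEquiv.range, Submodule.map_top] at hN

theorem Module.Injective.of_linearEquiv [Module.Injective A I] (e : I ≃ₗ[A] J) :
    Module.Injective A J := by
  refine ⟨fun X Y _ _ _ _ f hf g => ?_⟩
  obtain ⟨h, hh⟩ := Module.Injective.out f hf (e.symm.toLinearMap ∘ₗ g)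
  exact ⟨e.toLinearMap ∘ₗ h, fun x => by simp [hh x]⟩

theorem Module.Injective.of_retract [Module.Injective A I] (s : J →ₗ[A] I) (r : I →ₗ[A] J)
    (h : r ∘ₗ s = LinearMap.id) : Module.Injective A J := by
  refine ⟨fun X Y _ _ _ _ f hf g => ?_⟩
  obtain ⟨k, hk⟩ := Module.Injective.out f hf (s ∘ₗ g)
  exact ⟨r ∘ₗ k, fun x => by simpa [hk x] using LinearMap.congr_fun h (g x)⟩

end Covers

/-! ### Existence of injective envelopes -/

section Envelope

variable {A : Type u} [Ring A]

/-- Every module has an injective envelope: a maximal essential extension of it inside an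
injective module. -/
theorem exists_isInjectiveEnvelope (M : Type u) [AddCommGroup M] [Module A M] :
    ∃ (I : ModuleCat.{u} A) (i : M →ₗ[A] I), IsInjectiveEnvelope i := by
  obtain ⟨⟨E, hE, m, hm⟩⟩ := CategoryTheory.EnoughInjectives.presentation (ModuleCat.of A M)
  have hEinj : Module.Injective A E := (Module.injective_iff_injective_object A E).2 hE
  let j : M →ₗ[A] E := m.hom
  have hj : Function.Injective j := (ModuleCat.mono_iff_injective m).1 hm
  -- The essential extensions of the image of `M` inside the injective module `E`; a maximal one
  -- will be the envelope.
  let s : Set (Submodule A E) := {N | LinearMap.range j ≤ N ∧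
    ∀ L : Submodule A E, L ≤ N → L ⊓ LinearMap.range j = ⊥ → L = ⊥}
  obtain ⟨N, hN0, hN⟩ : ∃ N, LinearMap.range j ≤ N ∧ Maximal (· ∈ s) N := by
    refine zorn_le_nonempty₀ s (fun c hcs hc y hy => ?_) _ ⟨le_rfl, fun L hL h => ?_⟩
    · refine ⟨sSup c, ⟨(hcs hy).1.trans (le_sSup hy), fun L hL h => ?_⟩, fun z => le_sSup⟩
      rw [eq_bot_iff]
      intro x hx
      obtain ⟨K, hK, hxK⟩ := (Submodule.mem_sSup_of_directed ⟨y, hy⟩ hc.directedOn).1 (hL hx)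
      have h' := (hcs hK).2 (L ⊓ K) inf_le_right
        (eq_bot_iff.2 ((inf_le_inf_right _ inf_le_left).trans h.le))
      rw [← h']
      exact ⟨hx, hxK⟩
    · rwa [inf_eq_left.2 hL] at h
  obtain ⟨C, -, hC⟩ : ∃ C, ⊥ ≤ C ∧ Maximal (· ∈ {C : Submodule A E | C ⊓ N = ⊥}) C := by
    refine zorn_le_nonempty₀ _ (fun c hcs hc y hy => ?_) _ (by simp)
    refine ⟨sSup c, ?_, fun z => le_sSup⟩
    rw [Set.mem_ofPred_eq, eq_bot_iff]
    rintro x ⟨hx, hxN⟩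
    obtain ⟨K, hK, hxK⟩ := (Submodule.mem_sSup_of_directed ⟨y, hy⟩ hc.directedOn).1 hx
    have hK' : K ⊓ N = ⊥ := hcs hK
    rw [← hK']
    exact ⟨hxK, hxN⟩
  have hCN : C ⊓ N = ⊥ := hC.1
  -- `N` embeds essentially in `E ⧸ C`; extend the inclusion of `N` to `E ⧸ C`.
  have hq : Function.Injective (C.mkQ ∘ₗ N.subtype) := by
    rw [← LinearMap.ker_eq_bot, eq_bot_iff]
    intro x hx
    have hx' : (x : E) ∈ C ⊓ N := ⟨by simpa using hx, x.2⟩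
    rw [hCN] at hx'
    simpa using hx'
  have hess : ∀ L : Submodule A (E ⧸ C), L ⊓ LinearMap.range (C.mkQ ∘ₗ N.subtype) = ⊥ →
      L = ⊥ := by
    intro L hL
    have h1 : L.comap C.mkQ ⊓ N = ⊥ ⊔ C ⊓ N := by
      rw [hCN, sup_bot_eq, eq_bot_iff]
      rintro x ⟨hx, hxN⟩
      have : C.mkQ x ∈ L ⊓ LinearMap.range (C.mkQ ∘ₗ N.subtype) := ⟨hx, ⟨x, hxN⟩, rfl⟩
      rw [hL, Submodule.mem_bot] at this
      have hx' : x ∈ C ⊓ N := ⟨by simpa using this, hxN⟩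
      rwa [hCN] at hx'
    have h2 : L.comap C.mkQ ≤ C := hC.2 (by simpa [hCN] using h1) (C.le_comap_mkQ L)
    rw [eq_bot_iff]
    intro y hy
    obtain ⟨x, rfl⟩ := C.mkQ_surjective y
    simpa using h2 hy
  obtain ⟨h, hh⟩ := Module.Injective.exists_extension _ hq N.subtype
  have hh' : ∀ x : N, h (C.mkQ x) = x := fun x => LinearMap.congr_fun hh x
  have hhinj : Function.Injective h := by
    rw [← LinearMap.ker_eq_bot]
    refine hess _ (eq_bot_iff.2 ?_)
    rintro _ ⟨hx, y, rfl⟩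
    have hy : (y : E) = 0 := by rw [← hh' y]; exact hx
    simp [hy]
  have hNr : N ≤ LinearMap.range h := fun x hx => ⟨C.mkQ x, hh' ⟨x, hx⟩⟩
  -- The image of `h` is again an essential extension of the image of `M`, so maximality of `N`
  -- leaves no room above `N`. Hence E → E/C → N is a retraction and `N` is injective.
  have hrange : LinearMap.range h ≤ N := by
    refine hN.2 ⟨hN0.trans hNr, fun L hL h0 => ?_⟩ hNr
    have h1 : L ⊓ N = ⊥ := hN.1.2 _ inf_le_right
      (eq_bot_iff.2 ((inf_le_inf_right _ inf_le_left).trans h0.le))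
    have h2 : L.comap h = ⊥ := by
      refine hess _ (eq_bot_iff.2 ?_)
      rintro _ ⟨hx, y, rfl⟩
      have hy : (y : E) ∈ L ⊓ N := ⟨by rw [← hh' y]; exact hx, y.2⟩
      rw [h1, Submodule.mem_bot] at hy
      simp [hy]
    rw [eq_bot_iff]
    intro x hx
    obtain ⟨y, rfl⟩ := hL hx
    have : y ∈ L.comap h := hx
    rw [h2, Submodule.mem_bot] at this
    simp [this]
  let r : E →ₗ[A] N := (h ∘ₗ C.mkQ).codRestrict N fun x => hrange ⟨_, rfl⟩
  have hNinj : Module.Injective A N :=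
    Module.Injective.of_retract N.subtype r (LinearMap.ext fun x => Subtype.ext (hh' x))
  refine ⟨ModuleCat.of A N, j.codRestrict N fun x => hN0 ⟨x, rfl⟩, hNinj, fun x y hxy => ?_,
    fun L hL => ?_⟩
  · exact hj (congrArg Subtype.val hxy)
  · have h1 : L.map N.subtype = ⊥ := by
      refine hN.1.2 _ (Submodule.map_subtype_le N L) (eq_bot_iff.2 ?_)
      rintro _ ⟨⟨x, hx, rfl⟩, y, hy⟩
      have : x ∈ L ⊓ LinearMap.range (j.codRestrict N fun x => hN0 ⟨x, rfl⟩) :=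
        ⟨hx, y, Subtype.ext hy⟩
      rw [hL, Submodule.mem_bot] at this
      simp [this]
    exact Submodule.map_injective_of_injective N.injective_subtype
      (h1.trans (Submodule.map_bot _).symm)

end Envelope

/-! ### Nonsplit extensions of simple modules -/

section Extensions

variable {A : Type u} [Ring A]

/-- There is a non-split extension `0 → U → Z → S → 0`. -/
def HasNonsplitExtension (S U : Type u) [AddCommGroup S] [Module A S] [AddCommGroup U]
    [Module A U] : Prop :=
  ∃ (Z : ModuleCat.{u} A) (i : U →ₗ[A] Z) (q : Z →ₗ[A] S), Function.Injective i ∧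
    Function.Surjective q ∧ LinearMap.range i = LinearMap.ker q ∧
      ∀ N : Submodule A Z, ¬ IsCompl (LinearMap.ker q) N

variable {M N P I S U S' U' : Type u} [AddCommGroup M] [Module A M] [AddCommGroup N] [Module A N]
  [AddCommGroup P] [Module A P] [AddCommGroup I] [Module A I] [AddCommGroup S] [Module A S]
  [AddCommGroup U] [Module A U] [AddCommGroup S'] [Module A S'] [AddCommGroup U'] [Module A U']

theorem HasNonsplitExtension.congr (h : HasNonsplitExtension (A := A) S U) (e : S ≃ₗ[A] S')
    (e' : U ≃ₗ[A] U') : HasNonsplitExtension (A := A) S' U' := by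
  obtain ⟨Z, i, q, hi, hq, hiq, hs⟩ := h
  have hk : LinearMap.ker (e.toLinearMap ∘ₗ q) = LinearMap.ker q := by
    rw [LinearMap.ker_comp, LinearEquiv.ker, Submodule.comap_bot]
  refine ⟨Z, i ∘ₗ e'.symm.toLinearMap, e.toLinearMap ∘ₗ q, hi.comp e'.symm.injective,
    e.surjective.comp hq, ?_, ?_⟩
  · rw [hk, ← hiq, LinearMap.range_comp, LinearEquiv.range, Submodule.map_top]
  · rwa [hk]

/-- Pushing out an inclusion along a surjection. -/
theorem exists_quotient_embedding {k : N →ₗ[A] M} (hk : Function.Injective k) {b : N →ₗ[A] U}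
    (hb : Function.Surjective b) {K : Submodule A M} (hK : K = (LinearMap.ker b).map k) :
    ∃ i : U →ₗ[A] (M ⧸ K), Function.Injective i ∧ ∀ x, i (b x) = K.mkQ (k x) := by
  subst hK
  let j : (N ⧸ LinearMap.ker b) →ₗ[A] (M ⧸ (LinearMap.ker b).map k) :=
    Submodule.mapQ _ _ k (Submodule.le_comap_map k _)
  have hj : Function.Injective j := by
    rw [← LinearMap.ker_eq_bot, eq_bot_iff]
    intro x hx
    obtain ⟨x, rfl⟩ := Submodule.mkQ_surjective _ x
    have hx' : k x ∈ (LinearMap.ker b).map k := by simpa [j] using hx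
    obtain ⟨y, hy, hxy⟩ := hx'
    rw [← hk hxy]
    simpa using hy
  refine ⟨j ∘ₗ (LinearMap.quotKerEquivOfSurjective b hb).symm.toLinearMap,
    hj.comp (LinearEquiv.injective _), fun x => ?_⟩
  have : (LinearMap.quotKerEquivOfSurjective b hb).symm (b x) = (LinearMap.ker b).mkQ x := by
    rw [LinearEquiv.symm_apply_eq]
    rfl
  rw [LinearMap.comp_apply, LinearEquiv.coe_coe, this]
  rfl

/-- Consecutive composition factors of a uniserial module have a non-split extension. -/
theorem IsUniserial.hasNonsplitExtension (hM : IsUniserial A M) [Nontrivial S] [Nontrivial U]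
    {q : M →ₗ[A] S} (hq : Function.Surjective q) {k : N →ₗ[A] M} (hk : Function.Injective k)
    (hkq : LinearMap.range k = LinearMap.ker q) {b : N →ₗ[A] U} (hb : Function.Surjective b) :
    HasNonsplitExtension (A := A) S U := by
  let K : Submodule A M := (LinearMap.ker b).map k
  obtain ⟨i, hi, hib⟩ := exists_quotient_embedding hk hb (K := K) rfl
  have hKq : K ≤ LinearMap.ker q := by
    rw [← hkq]
    exact LinearMap.map_le_range
  let q' : (M ⧸ K) →ₗ[A] S := K.liftQ q hKq
  have hq' : Function.Surjective q' := fun s => by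
    obtain ⟨x, rfl⟩ := hq s
    exact ⟨K.mkQ x, by simp [q']⟩
  have hiq : LinearMap.range i = LinearMap.ker q' := by
    have : i ∘ₗ b = K.mkQ ∘ₗ k := LinearMap.ext hib
    rw [Submodule.ker_liftQ, ← hkq, ← LinearMap.range_comp, ← this,
      LinearMap.range_comp_of_range_eq_top _ (LinearMap.range_eq_top.2 hb)]
  refine ⟨ModuleCat.of A (M ⧸ K), i, q', hi, hq', hiq, fun L hL => ?_⟩
  have hu : IsUniserial A (M ⧸ K) := hM.of_surjective K.mkQ K.mkQ_surjective
  -- In a chain, complementary submodules must be zero and the whole module; both options are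
  -- excluded since `U` and `S` are nonzero.
  rcases hu (LinearMap.ker q') L with h | h
  · have h1 : LinearMap.ker q' = ⊥ := le_bot_iff.1 (hL.disjoint le_rfl h)
    rw [← hiq, LinearMap.range_eq_bot] at h1
    exact not_subsingleton U ⟨fun x y => hi (by rw [h1]; rfl)⟩
  · have h1 : LinearMap.ker q' = ⊤ := top_le_iff.1 (hL.codisjoint le_rfl h)
    rw [LinearMap.ker_eq_top] at h1
    refine not_subsingleton S ⟨fun x y => ?_⟩
    obtain ⟨x, rfl⟩ := hq' x
    obtain ⟨y, rfl⟩ := hq' y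
    rw [h1]
    rfl

theorem HasNonsplitExtension.not_projective (h : HasNonsplitExtension (A := A) S U) :
    ¬ Module.Projective A S := by
  intro hS
  obtain ⟨Z, i, q, hi, hq, hiq, hs⟩ := h
  obtain ⟨s, hs'⟩ := Module.projective_lifting_property q LinearMap.id hq
  exact hs _ (LinearMap.isCompl_of_proj (p := LinearMap.ker q)
    (f := (LinearMap.id - s ∘ₗ q).codRestrict _ fun x => by
      simpa [sub_eq_zero] using (LinearMap.congr_fun hs' (q x)).symm) (fun x => by
        ext
        have := x.2
        rw [LinearMap.mem_ker] at this
        simp [this]))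

theorem HasNonsplitExtension.not_injective (h : HasNonsplitExtension (A := A) S U) :
    ¬ Module.Injective A U := by
  intro hU
  obtain ⟨Z, i, q, hi, hq, hiq, hs⟩ := h
  obtain ⟨r, hr⟩ := Module.Injective.exists_extension i hi LinearMap.id
  refine hs _ (LinearMap.isCompl_of_proj (p := LinearMap.ker q)
    (f := (i ∘ₗ r).codRestrict _ fun x => by rw [← hiq]; exact ⟨r x, rfl⟩) ?_)
  rintro ⟨x, hx⟩
  rw [← hiq] at hx
  obtain ⟨y, rfl⟩ := hx
  ext
  simpa using congrArg i (LinearMap.congr_fun hr y)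

/-- The kernel of a surjection from a projective module to `S` maps onto `U` if `U` is simple and
there is a nonsplit extension of `S` by `U`. -/
theorem HasNonsplitExtension.exists_surjective_ker [IsSimpleModule A U]
    (h : HasNonsplitExtension (A := A) S U) [Module.Projective A P] {p : P →ₗ[A] S}
    (hp : Function.Surjective p) :
    ∃ b : LinearMap.ker p →ₗ[A] U, Function.Surjective b := by
  obtain ⟨Z, i, q, hi, hq, hiq, hs⟩ := h
  obtain ⟨h, hh⟩ := Module.projective_lifting_property q p hq
  have hh' : ∀ x, q (h x) = p x := fun x => LinearMap.congr_fun hh x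
  have hsup : LinearMap.ker q ⊔ LinearMap.range h = ⊤ := by
    refine eq_top_iff.2 fun z _ => ?_
    obtain ⟨x, hx⟩ := hp (q z)
    refine Submodule.mem_sup.2 ⟨z - h x, ?_, h x, ⟨x, rfl⟩, by abel⟩
    rw [LinearMap.mem_ker, map_sub, hh', hx, sub_self]
  -- The kernel of `q` is a copy of the simple module `U`. If it were not contained in the image of
  -- `h`, it would meet that image trivially and the image would split the extension.
  have hle : LinearMap.ker q ≤ LinearMap.range h := by
    by_contra hle
    have hat : IsAtom (LinearMap.ker q) := hiq ▸ isAtom_range_of_injective i hi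
    exact hs _ ⟨hat.not_le_iff_disjoint.1 hle, codisjoint_iff.2 hsup⟩
  rw [← hiq] at hle
  let e := LinearEquiv.ofInjective i hi
  refine ⟨e.symm.toLinearMap ∘ₗ ((h ∘ₗ (LinearMap.ker p).subtype).codRestrict
    (LinearMap.range i) fun x => ?_), fun u => ?_⟩
  · rw [hiq, LinearMap.mem_ker, LinearMap.comp_apply, hh']
    exact x.2
  · obtain ⟨x, hx⟩ := hle ⟨u, rfl⟩
    refine ⟨⟨x, ?_⟩, ?_⟩
    · rw [LinearMap.mem_ker, ← hh', hx, ← LinearMap.mem_ker, ← hiq]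
      exact ⟨u, rfl⟩
    · rw [LinearMap.comp_apply, LinearEquiv.coe_coe, LinearEquiv.symm_apply_eq]
      exact Subtype.ext hx

/-- A nonsplit extension of `S` by `U` embeds `S` into the cosyzygy of `U`. -/
theorem HasNonsplitExtension.exists_injective_quotient [IsSimpleModule A S]
    (h : HasNonsplitExtension (A := A) S U) [Module.Injective A I] {j : U →ₗ[A] I}
    (hj : Function.Injective j) :
    ∃ c : S →ₗ[A] (I ⧸ LinearMap.range j), Function.Injective c := by
  obtain ⟨Z, i, q, hi, hq, hiq, hs⟩ := h
  obtain ⟨h, hh⟩ := Module.Injective.exists_extension i hi j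
  have hh' : ∀ x, h (i x) = j x := fun x => LinearMap.congr_fun hh x
  have hdisj : Disjoint (LinearMap.ker q) (LinearMap.ker h) := by
    rw [← hiq, disjoint_iff, eq_bot_iff]
    rintro _ ⟨⟨u, rfl⟩, hu⟩
    have : u = 0 := hj (by rw [← hh', map_zero]; exact hu)
    simp [this]
  -- Dually, the kernel of `q` is maximal, so a nonzero kernel of `h`, being disjoint from it, would
  -- be a complement.
  have hker : LinearMap.ker h = ⊥ := by
    by_contra hne
    have hco : IsCoatom (LinearMap.ker q) := isCoatom_ker_of_surjective q hq
    exact hs _ ⟨hdisj, hco.not_le_iff_codisjoint.1 fun hle =>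
      hne (disjoint_self.1 (hdisj.mono_left hle))⟩
  have hrange : LinearMap.range (h ∘ₗ i) = LinearMap.range j := by rw [hh]
  have hle : LinearMap.ker q ≤ LinearMap.ker ((LinearMap.range j).mkQ ∘ₗ h) := by
    rw [← hiq]
    rintro _ ⟨u, rfl⟩
    simp [hh']
  let e := LinearMap.quotKerEquivOfSurjective q hq
  suffices hinj : Function.Injective ((LinearMap.ker q).liftQ _ hle) from
    ⟨((LinearMap.ker q).liftQ _ hle) ∘ₗ e.symm.toLinearMap, hinj.comp e.symm.injective⟩
  rw [← LinearMap.ker_eq_bot, eq_bot_iff]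
  intro x hx
  obtain ⟨z, rfl⟩ := Submodule.mkQ_surjective _ x
  have hz : h z ∈ LinearMap.range j := by simpa using hx
  obtain ⟨u, hu⟩ := hz
  rw [← hh'] at hu
  have : i u = z := LinearMap.ker_eq_bot.1 hker hu
  simp only [Submodule.mem_bot, Submodule.mkQ_apply, Submodule.Quotient.mk_eq_zero]
  rw [← hiq, ← this]
  exact ⟨u, rfl⟩

end Extensions

/-! ### Decomposing the identity into indecomposable idempotents -/

section Decomposition

variable {A : Type u} [Ring A] {M : Type u} [AddCommGroup M] [Module A M]

/-- An idempotent endomorphism whose image is decomposable is a sum of two idempotent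
endomorphisms with smaller images. -/
theorem exists_idempotent_add {π : Module.End A M} (hπ : IsIdempotentElem π)
    (hne : LinearMap.range π ≠ ⊥) (hdec : ¬ IsIndecomposable A (LinearMap.range π)) :
    ∃ π₁ π₂ : Module.End A M, IsIdempotentElem π₁ ∧ IsIdempotentElem π₂ ∧ π = π₁ + π₂ ∧
      LinearMap.range π₁ < LinearMap.range π ∧ LinearMap.range π₂ < LinearMap.range π := by
  have : Nontrivial (LinearMap.range π) := Submodule.nontrivial_iff_ne_bot.2 hne
  have hπ' : ∀ x, π (π x) = π x := fun x => LinearMap.congr_fun hπ x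
  simp only [IsIndecomposable, this, true_and, not_forall, not_or] at hdec
  obtain ⟨N, N', hc, hN, hN'⟩ := hdec
  have hres : ∀ x : LinearMap.range π, π x = x := by
    rintro ⟨_, y, rfl⟩
    exact hπ' y
  -- Project onto `K` along `L` after applying `π`. Since `L` is nonzero the image shrinks strictly,
  -- which later drives the induction on submodules.
  have key : ∀ (K L : Submodule A (LinearMap.range π)) (h : IsCompl K L), L ≠ ⊥ →
      ∃ ρ : Module.End A M, IsIdempotentElem ρ ∧ LinearMap.range ρ < LinearMap.range π ∧
        ∀ x, ρ x = (K.projectionOnto L h (π.rangeRestrict x) : LinearMap.range π) := by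
    intro K L h hL
    let ρ : Module.End A M := (LinearMap.range π).subtype ∘ₗ K.subtype ∘ₗ
      K.projectionOnto L h ∘ₗ π.rangeRestrict
    have hρ : ∀ x, ρ x = (K.projectionOnto L h (π.rangeRestrict x) : LinearMap.range π) :=
      fun x => rfl
    have hπρ : ∀ x, π.rangeRestrict (ρ x) = (K.projectionOnto L h (π.rangeRestrict x) :
      LinearMap.range π) := fun x => Subtype.ext (hres _)
    refine ⟨ρ, ?_, lt_of_le_of_ne ?_ ?_, hρ⟩
    · ext x
      simp only [Module.End.mul_apply]
      rw [hρ (ρ x), hπρ, Submodule.projectionOnto_apply_left, ← hρ]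
    · rintro _ ⟨x, rfl⟩
      exact Subtype.property _
    · intro heq
      apply hL
      rw [eq_bot_iff]
      intro y hy
      obtain ⟨x, hx⟩ : (y : M) ∈ LinearMap.range ρ := by rw [heq]; exact y.2
      have : y ∈ K := by
        have h2 : y = (K.projectionOnto L h (π.rangeRestrict x) : LinearMap.range π) :=
          Subtype.ext (by rw [← hρ, hx])
        rw [h2]
        exact Subtype.property _
      have h3 : y ∈ K ⊓ L := ⟨this, hy⟩
      rwa [h.inf_eq_bot] at h3
  obtain ⟨π₁, h1, h1', h1''⟩ := key N N' hc hN'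
  obtain ⟨π₂, h2, h2', h2''⟩ := key N' N hc.symm hN
  refine ⟨π₁, π₂, h1, h2, ?_, h1', h2'⟩
  ext x
  rw [LinearMap.add_apply, h1'', h2'', ← Submodule.coe_add, Submodule.coe_projectionOnto_apply,
    Submodule.coe_projectionOnto_apply, Submodule.projection_add_projection_eq_self]
  rfl

/-- In an artinian module the identity is a sum of idempotent endomorphisms with indecomposable
images. -/
theorem one_mem_closure_indecomposable (A M : Type u) [Ring A] [AddCommGroup M] [Module A M]
    [IsArtinian A M] : (1 : Module.End A M) ∈ AddSubmonoid.closure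
      {π : Module.End A M | IsIdempotentElem π ∧ IsIndecomposable A (LinearMap.range π)} := by
  have key : ∀ (N : Submodule A M) (π : Module.End A M), IsIdempotentElem π →
      LinearMap.range π = N → π ∈ AddSubmonoid.closure
      {π : Module.End A M | IsIdempotentElem π ∧ IsIndecomposable A (LinearMap.range π)} := by
    intro N
    induction N using WellFoundedLT.induction with
    | ind N ih =>
      rintro π hπ rfl
      by_cases hne : LinearMap.range π = ⊥
      · rw [LinearMap.range_eq_bot.1 hne]
        exact AddSubmonoid.zero_mem _
      by_cases hdec : IsIndecomposable A (LinearMap.range π)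
      · exact AddSubmonoid.subset_closure ⟨hπ, hdec⟩
      obtain ⟨π₁, π₂, h1, h2, h3, h4, h5⟩ := exists_idempotent_add hπ hne hdec
      rw [h3]
      exact add_mem (ih _ h4 _ h1 rfl) (ih _ h5 _ h2 rfl)
  exact key _ 1 IsIdempotentElem.one rfl

theorem projective_range_of_idempotent [Module.Projective A M] {π : Module.End A M}
    (hπ : IsIdempotentElem π) : Module.Projective A (LinearMap.range π) := by
  refine Module.Projective.of_split (LinearMap.range π).subtype π.rangeRestrict ?_
  ext ⟨_, y, rfl⟩
  exact LinearMap.congr_fun hπ y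

end Decomposition

/-! ### Matlis duality over a commutative artinian ring -/

section Matlis

variable {R : Type u} [CommRing R] {J : Type u} [AddCommGroup J] [Module R J]

/-- The maps from a simple module to an injective envelope of `R / rad R` form a cyclic module,
generated by any nonzero map. -/
theorem exists_smul_eq_of_simple {i : (R ⧸ Ring.jacobson R) →ₗ[R] J}
    (hi : IsInjectiveEnvelope i) {X : Type u} [AddCommGroup X] [Module R X] [IsSimpleModule R X]
    {φ : X →ₗ[R] J} (hφ : φ ≠ 0) (ψ : X →ₗ[R] J) : ∃ r : R, r • φ = ψ := by
  have hle : ∀ χ : X →ₗ[R] J, χ ≠ 0 → LinearMap.range χ ≤ LinearMap.range i := by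
    intro χ hχ
    have hat := isAtom_range_of_injective χ (LinearMap.injective_of_ne_zero hχ)
    by_contra h
    exact hat.1 (hi.2.2 _ (hat.not_le_iff_disjoint.1 h).eq_bot)
  obtain ⟨x, hx⟩ : ∃ x, φ x ≠ 0 := by
    by_contra! h
    exact hφ (LinearMap.ext h)
  have hx0 : x ≠ 0 := fun h => hx (by rw [h, map_zero])
  suffices h : ∃ r : R, r • φ x = ψ x by
    obtain ⟨r, hr⟩ := h
    refine ⟨r, LinearMap.ext fun y => ?_⟩
    obtain ⟨s, rfl⟩ := IsSimpleModule.toSpanSingleton_surjective R hx0 y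
    simp only [LinearMap.toSpanSingleton_apply, LinearMap.smul_apply, map_smul]
    rw [← hr, smul_comm]
  by_cases hψ : ψ = 0
  · exact ⟨0, by simp [hψ]⟩
  obtain ⟨a, ha⟩ := hle φ hφ ⟨x, rfl⟩
  obtain ⟨b, hb⟩ := hle ψ hψ ⟨x, rfl⟩
  obtain ⟨a, rfl⟩ := Submodule.mkQ_surjective _ a
  obtain ⟨b, rfl⟩ := Submodule.mkQ_surjective _ b
  have hann : ∀ (c : R) (χ : X →ₗ[R] J), i ((Ring.jacobson R).mkQ c) = χ x → ∀ r : R,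
      r • x = 0 → r * c ∈ Ring.jacobson R := by
    intro c χ hc r hr
    have : i ((Ring.jacobson R).mkQ (r • c)) = 0 := by
      rw [map_smul, map_smul, hc, ← map_smul, hr, map_zero]
    exact (Submodule.Quotient.mk_eq_zero _).1 (hi.2.1 (this.trans (map_zero i).symm))
  have haJ : a ∉ Ring.jacobson R := by
    intro h
    apply hx
    rw [← ha, Submodule.mkQ_apply, (Submodule.Quotient.mk_eq_zero _).2 h, map_zero]
  let m : Ideal R := LinearMap.ker (LinearMap.toSpanSingleton R X x)
  have hmax : m.IsMaximal :=
    ⟨isCoatom_ker_of_surjective _ (IsSimpleModule.toSpanSingleton_surjective R hx0)⟩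
  -- A class in R/rad R whose image under `i` is a value at `x` is killed by `m` = ann(x), so it is
  -- supported at `m` alone: its representative lies in every other maximal ideal.
  have hother : ∀ (c : R) (χ : X →ₗ[R] J), i ((Ring.jacobson R).mkQ c) = χ x →
      ∀ n : Ideal R, n.IsMaximal → n ≠ m → c ∈ n := by
    intro c χ hc n hn hne
    obtain ⟨r, hr, hrn⟩ := SetLike.not_le_iff_exists.1 fun h => hne (hmax.eq_of_le hn.ne_top h).symm
    have := hann c χ hc r (by simpa [m] using hr)
    exact (hn.isPrime.mem_or_mem (Ring.jacobson_le_of_isMaximal n this)).resolve_left hrn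
  have ham : a ∉ m := by
    intro h
    apply haJ
    rw [Ring.jacobson_eq_sInf_isMaximal, Submodule.mem_sInf]
    intro n hn
    by_cases hnm : n = m
    · rwa [hnm]
    · exact hother a φ ha n hn hnm
  obtain ⟨y, z, hz, hyz⟩ := hmax.exists_inv ham
  -- Here `y` inverts `a` modulo `m`, so the difference lies in `m`; at every other maximal ideal
  -- both `a` and `b` vanish.
  have hJ : b - b * y * a ∈ Ring.jacobson R := by
    rw [Ring.jacobson_eq_sInf_isMaximal, Submodule.mem_sInf]
    intro n hn
    by_cases hnm : n = m
    · have : b - b * y * a = b * z := by linear_combination (-b) * hyz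
      rw [hnm, this]
      exact m.mul_mem_left _ hz
    · exact n.sub_mem (hother b ψ hb n hn hnm) (Ideal.mul_mem_left n _ (hother a φ ha n hn hnm))
  refine ⟨b * y, ?_⟩
  rw [← ha, ← hb, ← map_smul, ← map_smul]
  congr 1
  symm
  exact (Submodule.Quotient.eq _).2 hJ

theorem length_dual_le_one {i : (R ⧸ Ring.jacobson R) →ₗ[R] J} (hi : IsInjectiveEnvelope i)
    (X : Type u) [AddCommGroup X] [Module R X] [IsSimpleModule R X] :
    Module.length R (X →ₗ[R] J) ≤ 1 := by
  rcases subsingleton_or_nontrivial (X →ₗ[R] J) with h | h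
  · simp
  · refine (Module.length_eq_one_iff.2 ?_).le
    exact isSimpleModule_iff_toSpanSingleton_surjective.2
      ⟨h, fun φ hφ ψ => exists_smul_eq_of_simple hi hφ ψ⟩

/-- Duality with respect to an injective envelope of `R / rad R` does not increase length. -/
theorem length_dual_le {i : (R ⧸ Ring.jacobson R) →ₗ[R] J} (hi : IsInjectiveEnvelope i)
    {X : Type u} [AddCommGroup X] [Module R X] (hX : IsFiniteLength R X) :
    Module.length R (X →ₗ[R] J) ≤ Module.length R X := by
  induction hX with
  | of_subsingleton => simp
  | @of_simple_quotient X _ _ N hS _ ih =>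
    let f : ((X ⧸ N) →ₗ[R] J) →ₗ[R] (X →ₗ[R] J) := LinearMap.lcomp R J N.mkQ
    let g : (X →ₗ[R] J) →ₗ[R] (N →ₗ[R] J) := LinearMap.lcomp R J N.subtype
    have hf : Function.Injective f := fun φ ψ h =>
      LinearMap.ext fun x => by
        obtain ⟨x, rfl⟩ := N.mkQ_surjective x
        exact LinearMap.congr_fun h x
    have hfg : Function.Exact f g.rangeRestrict := by
      intro φ
      constructor
      · intro h
        have h' : ∀ x ∈ N, φ x = 0 := fun x hx =>
          LinearMap.congr_fun (congrArg Subtype.val h) ⟨x, hx⟩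
        exact ⟨N.liftQ φ h', LinearMap.ext fun x => rfl⟩
      · rintro ⟨ψ, rfl⟩
        ext x
        exact (congrArg ψ ((Submodule.Quotient.mk_eq_zero N).2 x.2)).trans (map_zero ψ)
    -- Only left exactness of the dual is used: `g` is replaced by its corestriction to its range,
    -- whose length is at most that of the dual of `N`.
    rw [Module.length_eq_add_of_exact f g.rangeRestrict hf g.surjective_rangeRestrict hfg,
      Module.length_eq_add_of_exact N.subtype N.mkQ N.injective_subtype N.mkQ_surjective
        (LinearMap.exact_subtype_mkQ N), add_comm]
    refine add_le_add ?_ ?_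
    · exact (Module.length_le_of_injective _ (LinearMap.range g).injective_subtype).trans ih
    · exact (length_dual_le_one hi _).trans (Module.length_eq_one (R := R) (M := X ⧸ N)).ge

/-- An injective envelope of `R / rad R` is a cogenerator. -/
theorem exists_dual_apply_ne_zero [IsArtinianRing R] {i : (R ⧸ Ring.jacobson R) →ₗ[R] J}
    (hi : IsInjectiveEnvelope i) {X : Type u} [AddCommGroup X] [Module R X] {x : X} (hx : x ≠ 0) :
    ∃ φ : X →ₗ[R] J, φ x ≠ 0 := by
  have := hi.1
  set I : Ideal R := LinearMap.ker (LinearMap.toSpanSingleton R X x) with hI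
  have hItop : I ≠ ⊤ := fun h => hx (by
    have : (1 : R) ∈ I := h ▸ Submodule.mem_top
    simpa [hI] using this)
  obtain ⟨m, hm, hIm⟩ := Ideal.exists_le_maximal I hItop
  -- Semisimplicity of R/rad R embeds R/m into it, hence into `J`. The resulting nonzero map
  -- R/ann(x) → J then extends from the cyclic submodule generated by `x` to `X`.
  have hss : IsSemisimpleModule R (R ⧸ Ring.jacobson R) :=
    (IsArtinian.isSemisimpleModule_iff_jacobson R _).2 (Module.jacobson_quotient_jacobson R R)
  obtain ⟨s, hs⟩ := IsSemisimpleModule.lifting_property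
    (Submodule.factor (Ring.jacobson_le_of_isMaximal m)) (Submodule.factor_surjective _)
    (LinearMap.id : (R ⧸ m) →ₗ[R] (R ⧸ m))
  have hone : (m.mkQ 1) ≠ 0 := fun h => by
    rw [Submodule.mkQ_apply, Submodule.Quotient.mk_eq_zero] at h
    exact hm.ne_top ((Ideal.eq_top_iff_one m).2 h)
  have hinj : Function.Injective (I.liftQ (LinearMap.toSpanSingleton R X x) le_rfl) := by
    rw [← LinearMap.ker_eq_bot]
    exact Submodule.ker_liftQ_eq_bot _ _ _ le_rfl
  obtain ⟨φ, hφ⟩ := Module.Injective.exists_extension _ hinj (i ∘ₗ s ∘ₗ Submodule.factor hIm)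
  refine ⟨φ, fun h => hone ?_⟩
  have h1 := LinearMap.congr_fun hφ (I.mkQ 1)
  simp only [LinearMap.comp_apply, Submodule.mkQ_apply, Submodule.liftQ_apply,
    LinearMap.toSpanSingleton_apply, one_smul, h] at h1
  have h2 := hi.2.1 ((map_zero i).trans h1)
  have h3 := LinearMap.congr_fun hs (m.mkQ 1)
  rw [LinearMap.comp_apply, LinearMap.id_apply] at h3
  rw [← h3]
  have h4 : s (m.mkQ 1) = 0 := h2.symm
  rw [h4, map_zero]

end Matlis

/-! ### Duals of right modules and an injective cogenerator -/

section Dual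

variable (R : Type u) {A : Type u} [CommRing R] [Ring A] [Algebra R A]
variable (X : Type u) [AddCommGroup X] [Module R X] [Module Aᵐᵒᵖ X] [IsScalarTower R Aᵐᵒᵖ X]

/-- The left `A`-module structure on the `R`-dual of a right `A`-module. -/
abbrev dualModule (J : Type u) [AddCommGroup J] [Module R J] : Module A (X →ₗ[R] J) where
  smul a φ := φ ∘ₗ Algebra.lsmul R R X (MulOpposite.op a)
  one_smul φ := LinearMap.ext fun x => congrArg φ (one_smul Aᵐᵒᵖ x)
  mul_smul a b φ := LinearMap.ext fun x =>
    congrArg φ (mul_smul (MulOpposite.op b) (MulOpposite.op a) x)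
  smul_zero a := rfl
  smul_add a φ ψ := rfl
  add_smul a b φ := LinearMap.ext fun x => by
    refine Eq.trans ?_ (map_add φ _ _)
    exact congrArg φ (add_smul (MulOpposite.op a) (MulOpposite.op b) x)
  zero_smul φ := LinearMap.ext fun x =>
    (congrArg φ (zero_smul Aᵐᵒᵖ x)).trans (map_zero φ)

theorem exists_isDual : ∃ Y : ModuleCat.{u} A, IsDual R (A := A) X Y := by
  obtain ⟨J, i, hi⟩ := exists_isInjectiveEnvelope (A := R) (R ⧸ Ring.jacobson R)
  let := dualModule R (A := A) X J
  exact ⟨ModuleCat.of A (X →ₗ[R] J), J, i, hi, AddEquiv.refl _, fun a y x => rfl⟩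

variable {R X}

/-- The dual of a simple module is simple. -/
theorem IsDual.isSimpleModule [IsArtinianRing R] [Module.Finite R X] [IsSimpleModule Aᵐᵒᵖ X]
    {Y : Type u} [AddCommGroup Y] [Module A Y] (h : IsDual R (A := A) X Y) :
    IsSimpleModule A Y := by
  obtain ⟨J, i, hi, e, he⟩ := h
  have hX : IsFiniteLength R X :=
    isFiniteLength_iff_isNoetherian_isArtinian.2 ⟨inferInstance, inferInstance⟩
  have hXtop : Module.length R X ≠ ⊤ := Module.length_ne_top_iff.2 hX
  have hDX := length_dual_le hi hX
  have hsmul : ∀ (r : R) (y : Y), e (algebraMap R A r • y) = r • e y := by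
    intro r y
    ext x
    rw [he, LinearMap.smul_apply, ← map_smul]
    congr 1
    rw [← algebraMap_smul Aᵐᵒᵖ r x]
    rfl
  have hnt : Nontrivial Y := by
    have := IsSimpleModule.nontrivial Aᵐᵒᵖ X
    obtain ⟨x, hx⟩ := exists_ne (0 : X)
    obtain ⟨φ, hφ⟩ := exists_dual_apply_ne_zero hi hx
    refine ⟨e.symm φ, 0, fun h => hφ ?_⟩
    rw [AddEquiv.symm_apply_eq, map_zero] at h
    rw [h, LinearMap.zero_apply]
  rw [isSimpleModule_iff]
  refine { toNontrivial := inferInstance, eq_bot_or_eq_top := fun L => ?_ }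
  let L' : Submodule R (X →ₗ[R] J) :=
    { carrier := {φ | e.symm φ ∈ L}
      add_mem' := fun hφ hψ => by
        simp only [Set.mem_ofPred_eq, map_add] at *
        exact add_mem hφ hψ
      zero_mem' := by simp
      smul_mem' := fun r φ hφ => by
        have : e.symm (r • φ) = algebraMap R A r • e.symm φ := by
          rw [AddEquiv.symm_apply_eq, hsmul, AddEquiv.apply_symm_apply]
        simp only [Set.mem_ofPred_eq, this] at *
        exact L.smul_mem _ hφ }
  -- The annihilator of `L` in `X`, a right submodule, hence zero or everything.
  let X' : Submodule Aᵐᵒᵖ X :=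
    { carrier := {x | ∀ y ∈ L, e y x = 0}
      add_mem' := fun hx hx' y hy => by rw [map_add, hx y hy, hx' y hy, add_zero]
      zero_mem' := fun y _ => map_zero _
      smul_mem' := fun a x hx y hy => by
        have := he a.unop y x
        rw [MulOpposite.op_unop] at this
        rw [← this]
        exact hx _ (L.smul_mem _ hy) }
  rcases eq_bot_or_eq_top X' with h | h
  · right
    -- If the annihilator vanishes, evaluation embeds `X` into the dual of `L'`. Then length X ≤
    -- length D(L') ≤ length L' ≤ length D(X) ≤ length X, which forces L' = D(X).
    have hinj : Function.Injective ((LinearMap.lcomp R J L'.subtype) ∘ₗ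
        (LinearMap.id : (X →ₗ[R] J) →ₗ[R] (X →ₗ[R] J)).flip) := by
      rw [← LinearMap.ker_eq_bot, eq_bot_iff]
      intro x hx
      have : x ∈ X' := fun y hy =>
        LinearMap.congr_fun hx ⟨e y, by change e.symm (e y) ∈ L; simpa using hy⟩
      rwa [h] at this
    have h1 : Module.length R X ≤ Module.length R (L' →ₗ[R] J) :=
      Module.length_le_of_injective _ hinj
    have hfin : IsFiniteLength R (X →ₗ[R] J) :=
      Module.length_ne_top_iff.1 (ne_top_of_le_ne_top hXtop hDX)
    have h2 := length_dual_le hi (hfin.of_injective L'.injective_subtype)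
    obtain ⟨_, _⟩ := isFiniteLength_iff_isNoetherian_isArtinian.1 hfin
    have htop : L' = ⊤ := by
      by_contra hne
      exact absurd (Submodule.length_lt hne) (not_lt.2 (hDX.trans (h1.trans h2)))
    rw [eq_top_iff]
    intro y _
    have : e y ∈ L' := htop ▸ Submodule.mem_top
    change e.symm (e y) ∈ L at this
    simpa using this
  · left
    rw [eq_bot_iff]
    intro y hy
    have : e y = 0 := LinearMap.ext fun x => by
      have : x ∈ X' := h ▸ Submodule.mem_top
      exact this y hy
    simpa using this

/-- Over an Artin algebra there is a finitely generated injective module into which every simple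
module embeds. -/
theorem exists_injective_cogenerator (R A : Type u) [CommRing R] [Ring A] [Algebra R A]
    [IsArtinianRing R] [Module.Finite R A] :
    ∃ I : ModuleCat.{u} A, Module.Injective A I ∧ Module.Finite A I ∧
      ∀ (S : Type u) [AddCommGroup S] [Module A S] [IsSimpleModule A S],
        ∃ i : S →ₗ[A] I, Function.Injective i := by
  obtain ⟨J, i, hi⟩ := exists_isInjectiveEnvelope (A := R) (R ⧸ Ring.jacobson R)
  have := hi.1
  let := dualModule R (A := A) A J
  have hsmul : ∀ (a : A) (φ : A →ₗ[R] J) (x : A), (a • φ) x = φ (x * a) := fun a φ x => rfl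
  -- the `A`-linear map corresponding to an `R`-linear map to `J`
  let adj : ∀ (M : Type u) [AddCommGroup M] [Module A M] [Module R M] [IsScalarTower R A M],
      (M →ₗ[R] J) → (M →ₗ[A] (A →ₗ[R] J)) := fun M _ _ _ _ φ =>
    { toFun := fun x => φ ∘ₗ (LinearMap.toSpanSingleton A M x).restrictScalars R
      map_add' := fun x y => by ext a; simp
      map_smul' := fun b x => by
        ext a
        rw [RingHom.id_apply, hsmul]
        simp [mul_smul] }
  refine ⟨ModuleCat.of A (A →ₗ[R] J), ⟨fun X Y _ _ _ _ f hf g => ?_⟩, ?_, fun S _ _ _ => ?_⟩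
  · let : Module R X := Module.compHom X (algebraMap R A)
    let : Module R Y := Module.compHom Y (algebraMap R A)
    have : IsScalarTower R A X := IsScalarTower.of_algebraMap_smul fun r x => rfl
    have : IsScalarTower R A Y := IsScalarTower.of_algebraMap_smul fun r x => rfl
    let g0 : X →ₗ[A] (A →ₗ[R] J) := g
    -- Evaluation at 1 is the adjunction Hom_A(X, Hom_R(A, J)) ≅ Hom_R(X, J), so injectivity of `J`
    -- over `R` transfers to `A`.
    let ev : X →ₗ[R] J :=
      { toFun := fun x => g0 x 1
        map_add' := fun x y => by rw [map_add, LinearMap.add_apply]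
        map_smul' := fun r x => by
          rw [← algebraMap_smul A r x, map_smul, hsmul, RingHom.id_apply, ← map_smul]
          congr 1
          rw [one_mul, Algebra.algebraMap_eq_smul_one] }
    obtain ⟨h, hh⟩ := Module.Injective.exists_extension (f.restrictScalars R) hf ev
    refine ⟨adj Y h, fun x => ?_⟩
    change adj Y h (f x) = g0 x
    ext a
    have h1 : adj Y h (f x) a = h (a • f x) := rfl
    have h2 : h (f (a • x)) = g0 (a • x) 1 := LinearMap.congr_fun hh (a • x)
    rw [h1, ← map_smul, h2, map_smul, hsmul, one_mul]
  · have hfl : IsFiniteLength R A :=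
      isFiniteLength_iff_isNoetherian_isArtinian.2 ⟨inferInstance, inferInstance⟩
    have hfin : IsFiniteLength R (A →ₗ[R] J) := Module.length_ne_top_iff.1
      (ne_top_of_le_ne_top (Module.length_ne_top_iff.2 hfl) (length_dual_le hi hfl))
    obtain ⟨_, _⟩ := isFiniteLength_iff_isNoetherian_isArtinian.1 hfin
    have : IsScalarTower R A (A →ₗ[R] J) := IsScalarTower.of_algebraMap_smul fun r φ => by
      ext x
      rw [hsmul, LinearMap.smul_apply, ← map_smul]
      congr 1
      rw [← Algebra.commutes, Algebra.smul_def]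
    exact Module.Finite.of_restrictScalars_finite R A (A →ₗ[R] J)
  · let : Module R S := Module.compHom S (algebraMap R A)
    have : IsScalarTower R A S := IsScalarTower.of_algebraMap_smul fun r x => rfl
    have := IsSimpleModule.nontrivial A S
    obtain ⟨x, hx⟩ := exists_ne (0 : S)
    obtain ⟨φ, hφ⟩ := exists_dual_apply_ne_zero hi hx
    refine ⟨adj S φ, LinearMap.injective_of_ne_zero fun h => hφ ?_⟩
    have h1 : adj S φ x 1 = φ ((1 : A) • x) := rfl
    rw [← one_smul A x, ← h1, h]
    rfl

end Dual

/-! ### Factoring maps through surjections -/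

section Factorization

variable {A : Type u} [Ring A] {M N P X : Type u} [AddCommGroup M] [Module A M] [AddCommGroup N]
  [Module A N] [AddCommGroup P] [Module A P] [AddCommGroup X] [Module A X]

theorem exists_comp_eq_of_ker_le {a : P →ₗ[A] N} (ha : Function.Surjective a) {g : P →ₗ[A] X}
    (h : LinearMap.ker a ≤ LinearMap.ker g) : ∃ k : N →ₗ[A] X, k ∘ₗ a = g := by
  refine ⟨(LinearMap.ker a).liftQ g h ∘ₗ (LinearMap.quotKerEquivOfSurjective a ha).symm.toLinearMap,
    LinearMap.ext fun x => ?_⟩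
  have : (LinearMap.quotKerEquivOfSurjective a ha).symm (a x) = (LinearMap.ker a).mkQ x := by
    rw [LinearEquiv.symm_apply_eq]
    rfl
  simp [this]

/-- Nested kernels give a surjective endomorphism of the Noetherian module `N`, which is injective.
This replaces counting lengths. -/
theorem ker_eq_of_ker_le [IsNoetherian A N] {a b : P →ₗ[A] N} (ha : Function.Surjective a)
    (hb : Function.Surjective b) (h : LinearMap.ker a ≤ LinearMap.ker b) :
    LinearMap.ker a = LinearMap.ker b := by
  obtain ⟨k, rfl⟩ := exists_comp_eq_of_ker_le ha h
  have hk : Function.Surjective k := Function.Surjective.of_comp hb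
  have hk' : Function.Injective k := IsNoetherian.injective_of_surjective_endomorphism k hk
  rw [LinearMap.ker_comp, LinearMap.ker_eq_bot.2 hk', Submodule.comap_bot]

theorem IsUniserial.ker_eq (hP : IsUniserial A P) [IsNoetherian A N] {a b : P →ₗ[A] N}
    (ha : Function.Surjective a) (hb : Function.Surjective b) :
    LinearMap.ker a = LinearMap.ker b := by
  rcases hP (LinearMap.ker a) (LinearMap.ker b) with h | h
  · exact ker_eq_of_ker_le ha hb h
  · exact (ker_eq_of_ker_le hb ha h).symm

/-- The kernel of `b` is the greatest proper submodule of `N`, so passing to the top of `N` only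
enlarges the kernel by a superfluous part. -/
theorem IsProjectiveCover.comp_of_isUniserial {q : P →ₗ[A] N} (hq : IsProjectiveCover q)
    (hN : IsUniserial A N) [IsSimpleModule A X] {b : N →ₗ[A] X} (hb : Function.Surjective b) :
    IsProjectiveCover (b ∘ₗ q) := by
  refine ⟨hq.1, hb.comp hq.2.1, fun L hL => hq.2.2 L ?_⟩
  have h : L.map q = ⊤ := by
    by_contra h
    have h1 : L ≤ LinearMap.ker (b ∘ₗ q) := by
      rw [LinearMap.ker_comp]
      exact Submodule.map_le_iff_le_comap.1 (hN.le_ker hb h)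
    rw [sup_eq_right.2 h1] at hL
    exact (isCoatom_ker_of_surjective (b ∘ₗ q) (hb.comp hq.2.1)).1 hL
  rw [← Submodule.comap_map_eq, h, Submodule.comap_top]

theorem exists_comp_ne_zero_of_one_mem_closure {s : Set (Module.End A P)}
    (hs : 1 ∈ AddSubmonoid.closure s) {φ : P →ₗ[A] M} (hφ : φ ≠ 0) : ∃ π ∈ s, φ ∘ₗ π ≠ 0 := by
  by_contra! h
  have key : ∀ π ∈ AddSubmonoid.closure s, φ ∘ₗ π = 0 := by
    intro π hπ
    induction hπ using AddSubmonoid.closure_induction with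
    | mem π hπ => exact h π hπ
    | zero => exact LinearMap.comp_zero _
    | add π ρ _ _ h1 h2 => rw [LinearMap.comp_add, h1, h2, add_zero]
  exact hφ (key _ hs)

/-- If `p : P → S` is a surjection from a projective module and `N` is a submodule of `W` with
`W / N ≅ S`, where `W` is contained in a uniserial module, then the kernel of `p` maps onto `N`. -/
theorem exists_surjective_ker_of_equiv [Module.Projective A P] [IsSimpleModule A M]
    {p : P →ₗ[A] M} (hp : Function.Surjective p) (hX : IsUniserial A X) {K W : Submodule A X}
    (hKW : K ≤ W) (e : M ≃ₗ[A] (W ⧸ LinearMap.range (Submodule.inclusion hKW))) :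
    ∃ t : LinearMap.ker p →ₗ[A] K, Function.Surjective t := by
  have hs := IsSimpleModule.congr e.symm
  obtain ⟨k, hk⟩ := Module.projective_lifting_property
    (LinearMap.range (Submodule.inclusion hKW)).mkQ (e.toLinearMap ∘ₗ p)
    (Submodule.mkQ_surjective _)
  have hk' : ∀ x, (LinearMap.range (Submodule.inclusion hKW)).mkQ (k x) = e (p x) :=
    fun x => LinearMap.congr_fun hk x
  have hks : Function.Surjective k := by
    refine (hX.of_injective _ W.injective_subtype).surjective_of_comp_ne_zero
      (Submodule.mkQ_surjective (LinearMap.range (Submodule.inclusion hKW))) fun h => ?_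
    have := IsSimpleModule.nontrivial A M
    obtain ⟨s, hs⟩ := exists_ne (0 : M)
    obtain ⟨x, rfl⟩ := hp s
    apply hs
    rw [← e.map_eq_zero_iff, ← hk' x]
    exact LinearMap.congr_fun h x
  have hmem : ∀ x, p x = 0 ↔ (k x : X) ∈ K := by
    intro x
    rw [← e.map_eq_zero_iff, ← hk' x, Submodule.mkQ_apply, Submodule.Quotient.mk_eq_zero,
      Submodule.range_inclusion]
    rfl
  refine ⟨(W.subtype ∘ₗ k ∘ₗ (LinearMap.ker p).subtype).codRestrict K
    fun x => (hmem x).1 x.2, ?_⟩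
  rintro ⟨y, hy⟩
  obtain ⟨z, hz⟩ := hks ⟨y, hKW hy⟩
  exact ⟨⟨z, (hmem z).2 (by rw [hz]; exact hy)⟩, Subtype.ext (congrArg W.subtype hz)⟩

end Factorization

/-! ### Simple modules over a Nakayama algebra: covers, envelopes, neighbours -/

section Nakayama

variable {R A : Type u} [CommRing R] [Ring A] [Algebra R A]

theorem IsConnectedNakayama.isArtinianRing (hA : IsConnectedNakayama R A) : IsArtinianRing A :=
  have := hA.artinian
  have := hA.finite
  IsArtinianRing.of_finite R A

theorem IsConnectedNakayama.isUniserial_range (hA : IsConnectedNakayama R A) {π : Module.End A A}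
    (hπ : IsIdempotentElem π) (hi : IsIndecomposable A (LinearMap.range π)) :
    IsUniserial A (LinearMap.range π) :=
  have := hA.isArtinianRing
  hA.projective_uniserial _ inferInstance (projective_range_of_idempotent hπ) hi

section Simple

variable {S : Type u} [AddCommGroup S] [Module A S] [IsSimpleModule A S]

/-- A nonzero map A → S stays nonzero on some indecomposable summand of `A`. That summand is
uniserial by hypothesis, so its map onto `S` is a cover. -/
theorem IsConnectedNakayama.exists_projective (hA : IsConnectedNakayama R A)
    (S : Type u) [AddCommGroup S] [Module A S] [IsSimpleModule A S] :
    ∃ (P : ModuleCat.{u} A) (p : P →ₗ[A] S), Module.Finite A P ∧ IsUniserial A P ∧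
      IsProjectiveCover p := by
  have := hA.isArtinianRing
  have := IsSimpleModule.nontrivial A S
  obtain ⟨s, hs⟩ := exists_ne (0 : S)
  have hφ : LinearMap.toSpanSingleton A S s ≠ 0 := fun h => hs (by
    simpa using LinearMap.congr_fun h 1)
  obtain ⟨π, ⟨h1, h2⟩, h3⟩ := exists_comp_ne_zero_of_one_mem_closure
    (one_mem_closure_indecomposable A A) hφ
  have hu := hA.isUniserial_range h1 h2
  have := projective_range_of_idempotent h1
  have hsurj : Function.Surjective
      (LinearMap.toSpanSingleton A S s ∘ₗ (LinearMap.range π).subtype) := by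
    refine LinearMap.surjective_of_ne_zero fun h => h3 (LinearMap.ext fun x => ?_)
    exact LinearMap.congr_fun h (π.rangeRestrict x)
  exact ⟨ModuleCat.of A (LinearMap.range π), _, inferInstanceAs (Module.Finite A (LinearMap.range π)),
    hu, hu.isProjectiveCover hsurj⟩

/-- The envelope embeds in the finitely generated cogenerator, so it is finitely generated. It is
indecomposable because every nonzero submodule contains the image of the simple module `S`. -/
theorem IsConnectedNakayama.exists_injective (hA : IsConnectedNakayama R A)
    (S : Type u) [AddCommGroup S] [Module A S] [IsSimpleModule A S] :
    ∃ (I : ModuleCat.{u} A) (i : S →ₗ[A] I), Module.Finite A I ∧ IsUniserial A I ∧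
      IsInjectiveEnvelope i := by
  have := hA.artinian
  have := hA.finite
  have := hA.isArtinianRing
  obtain ⟨E, hE, hEf, hES⟩ := exists_injective_cogenerator R A
  obtain ⟨j, hj⟩ := hES S
  obtain ⟨I, i, hi⟩ := exists_isInjectiveEnvelope (A := A) S
  have := hi.1
  obtain ⟨f, hf⟩ := Module.Injective.exists_extension i hi.2.1 j
  have hfi : Function.Injective f := hi.injective_of_comp (by rwa [hf])
  have hfin : Module.Finite A I := Module.Finite.of_injective f hfi
  have hat := isAtom_range_of_injective i hi.2.1
  have hle : ∀ K : Submodule A I, K ≠ ⊥ → LinearMap.range i ≤ K := fun K hK => by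
    by_contra h
    exact hK (hi.2.2 K (hat.not_le_iff_disjoint.1 h).symm.eq_bot)
  refine ⟨I, i, hfin, hA.injective_uniserial I hfin hi.1 ⟨?_, fun K L h => ?_⟩, hi⟩
  · have := IsSimpleModule.nontrivial A S
    exact hi.2.1.nontrivial
  · by_contra! h'
    exact hat.1 (le_bot_iff.1 (h.disjoint (hle K h'.1) (hle L h'.2)))

theorem IsConnectedNakayama.of_isProjectiveCover (hA : IsConnectedNakayama R A)
    {P : Type u} [AddCommGroup P] [Module A P] {p : P →ₗ[A] S} (hp : IsProjectiveCover p) :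
    Module.Finite A P ∧ IsUniserial A P := by
  obtain ⟨Q, q, hf, hu, hq⟩ := hA.exists_projective S
  obtain ⟨e, -⟩ := hq.exists_equiv hp
  exact ⟨Module.Finite.equiv e, hu.of_surjective e.toLinearMap e.surjective⟩

theorem IsConnectedNakayama.of_isInjectiveEnvelope (hA : IsConnectedNakayama R A)
    {I : Type u} [AddCommGroup I] [Module A I] {i : S →ₗ[A] I} (hi : IsInjectiveEnvelope i) :
    Module.Finite A I ∧ IsUniserial A I := by
  obtain ⟨Q, q, hf, hu, hq⟩ := hA.exists_injective S
  obtain ⟨e, -⟩ := hq.exists_equiv hi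
  exact ⟨Module.Finite.equiv e, hu.of_surjective e.toLinearMap e.surjective⟩

end Simple

/-- The envelope of the simple socle of `X` works: the extension of the socle inclusion to `X` is
injective because it is so on the socle. -/
theorem IsConnectedNakayama.exists_uniserial_injective (hA : IsConnectedNakayama R A)
    {X : Type u} [AddCommGroup X] [Module A X] [Module.Finite A X] [Nontrivial X]
    (hX : IsUniserial A X) : ∃ (E : ModuleCat.{u} A) (j : X →ₗ[A] E), Module.Injective A E ∧
      IsUniserial A E ∧ Function.Injective j := by
  have := hA.isArtinianRing
  have := hX.isSimpleModule_socle
  obtain ⟨E, i, -, hE, hi⟩ := hA.exists_injective (socle A X)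
  have := hi.1
  obtain ⟨j, hj⟩ := Module.Injective.exists_extension _ (socle A X).injective_subtype i
  refine ⟨E, j, hi.1, hE, hX.injective_of_comp_ne_zero (socle A X).injective_subtype ?_⟩
  rw [hj]
  intro h
  have := IsSimpleModule.nontrivial A (socle A X)
  obtain ⟨x, hx⟩ := exists_ne (0 : socle A X)
  exact hx (hi.2.1 (by rw [h]; rfl))

section Unique

variable {S S' U U' : Type u} [AddCommGroup S] [Module A S] [IsSimpleModule A S]
  [AddCommGroup S'] [Module A S'] [IsSimpleModule A S'] [AddCommGroup U] [Module A U]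
  [IsSimpleModule A U] [AddCommGroup U'] [Module A U'] [IsSimpleModule A U']

/-- Both modules are simple quotients of the uniserial module rad P(S). Dually, in `equiv_left` both
are simple submodules of I(U)/U. -/
theorem IsConnectedNakayama.equiv_right (hA : IsConnectedNakayama R A)
    (h : HasNonsplitExtension (A := A) S U) (h' : HasNonsplitExtension (A := A) S U') :
    Nonempty (U ≃ₗ[A] U') := by
  obtain ⟨P, p, -, hu, hp⟩ := hA.exists_projective S
  have := hp.1
  obtain ⟨b, hb⟩ := h.exists_surjective_ker hp.2.1
  obtain ⟨b', hb'⟩ := h'.exists_surjective_ker hp.2.1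
  exact (hu.of_injective _ (LinearMap.ker p).injective_subtype).equiv_of_quotients hb hb'

theorem IsConnectedNakayama.equiv_left (hA : IsConnectedNakayama R A)
    (h : HasNonsplitExtension (A := A) S U) (h' : HasNonsplitExtension (A := A) S' U) :
    Nonempty (S ≃ₗ[A] S') := by
  obtain ⟨I, i, -, hu, hi⟩ := hA.exists_injective U
  have := hi.1
  obtain ⟨c, hc⟩ := h.exists_injective_quotient hi.2.1
  obtain ⟨c', hc'⟩ := h'.exists_injective_quotient hi.2.1
  exact (hu.of_surjective _ (LinearMap.range i).mkQ_surjective).equiv_of_submodules hc hc'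

theorem IsConnectedNakayama.exists_right (hA : IsConnectedNakayama R A)
    (h : ¬ Module.Projective A S) :
    ∃ U : ModuleCat.{u} A, IsSimpleModule A U ∧ HasNonsplitExtension (A := A) S U := by
  have := hA.isArtinianRing
  obtain ⟨P, p, hf, hu, hp⟩ := hA.exists_projective S
  have := hp.1
  have hne : Nontrivial (LinearMap.ker p) := by
    rw [Submodule.nontrivial_iff_ne_bot]
    intro hk
    exact h (Module.Projective.of_equiv
      (LinearEquiv.ofBijective p ⟨LinearMap.ker_eq_bot.1 hk, hp.2.1⟩))
  have hk := hu.of_injective _ (LinearMap.ker p).injective_subtype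
  have hs := hk.isSimpleModule_top
  have := IsSimpleModule.nontrivial A (Top A (LinearMap.ker p))
  have := IsSimpleModule.nontrivial A S
  exact ⟨ModuleCat.of A (Top A (LinearMap.ker p)), hs, hu.hasNonsplitExtension hp.2.1
    (LinearMap.ker p).injective_subtype (Submodule.range_subtype _) (Submodule.mkQ_surjective _)⟩

/-- The next composition factor above a submodule of a uniserial module. -/
theorem exists_next_factor {M : Type u} [AddCommGroup M] [Module A M] [IsArtinian A M]
    (hM : IsUniserial A M) {N : Submodule A M} (hN : N ≠ ⊤) {b : N →ₗ[A] U}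
    (hb : Function.Surjective b) :
    ∃ (W : Submodule A M) (h : N ≤ W), N ⋖ W ∧
      IsSimpleModule A (W ⧸ LinearMap.range (Submodule.inclusion h)) ∧
      HasNonsplitExtension (A := A) (W ⧸ LinearMap.range (Submodule.inclusion h)) U := by
  obtain ⟨W, hW, -⟩ := exists_covBy_le_of_lt hN.lt_top
  have hs : IsSimpleModule A (W ⧸ LinearMap.range (Submodule.inclusion hW.le)) := by
    rw [Submodule.range_inclusion]
    exact (covBy_iff_quot_is_simple hW.le).1 hW
  have := IsSimpleModule.nontrivial A U
  have := IsSimpleModule.nontrivial A (W ⧸ LinearMap.range (Submodule.inclusion hW.le))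
  exact ⟨W, hW.le, hW, hs, (hM.of_injective _ W.injective_subtype).hasNonsplitExtension
    (Submodule.mkQ_surjective _) (Submodule.inclusion_injective hW.le)
    (Submodule.ker_mkQ _).symm hb⟩

theorem IsConnectedNakayama.exists_left (hA : IsConnectedNakayama R A)
    (h : ¬ Module.Injective A U) :
    ∃ S : ModuleCat.{u} A, IsSimpleModule A S ∧ HasNonsplitExtension (A := A) S U := by
  have := hA.isArtinianRing
  obtain ⟨I, i, hf, hu, hi⟩ := hA.exists_injective U
  have := hi.1
  have hne : LinearMap.range i ≠ ⊤ := fun hr => h (Module.Injective.of_linearEquiv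
    (LinearEquiv.ofBijective i ⟨hi.2.1, LinearMap.range_eq_top.1 hr⟩).symm)
  obtain ⟨W, hW, -, hs, hext⟩ := exists_next_factor hu hne
    (b := (LinearEquiv.ofInjective i hi.2.1).symm.toLinearMap) (LinearEquiv.surjective _)
  exact ⟨ModuleCat.of A _, hs, hext⟩

end Unique

/-! ### The Auslander–Reiten translate of a simple module -/

section Translate

variable {P₀ P₁ S U X : Type u} [AddCommGroup P₀] [Module A P₀] [AddCommGroup P₁] [Module A P₁]
  [AddCommGroup S] [Module A S] [AddCommGroup U] [Module A U] [AddCommGroup X] [Module A X]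
  [IsSimpleModule A S] [IsSimpleModule A U]

/-- If `g : P₁ → X` is a non-surjective map to a uniserial module, then `g` factors through
a nonzero map `P₁ → P(S)` with image `rad P(S)`. -/
theorem IsConnectedNakayama.exists_factorization (hA : IsConnectedNakayama R A)
    (hP₀ : IsUniserial A P₀) (hP₁ : IsUniserial A P₁) [Module.Projective A P₀]
    {p : P₀ →ₗ[A] S} (hp : Function.Surjective p) {f : P₁ →ₗ[A] P₀} (hf : f ≠ 0)
    (hfp : LinearMap.range f = LinearMap.ker p) (hX : IsUniserial A X) [Module.Finite A X]
    {g : P₁ →ₗ[A] X} (hg : ¬ Function.Surjective g) : ∃ h : P₀ →ₗ[A] X, h ∘ₗ f = g := by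
  have := hA.isArtinianRing
  by_cases hg0 : g = 0
  · exact ⟨0, by rw [hg0, LinearMap.zero_comp]⟩
  have hNtop : LinearMap.range g ≠ ⊤ := fun h => hg (LinearMap.range_eq_top.1 h)
  have hNbot : LinearMap.range g ≠ ⊥ := fun h => hg0 (LinearMap.range_eq_bot.1 h)
  have hNnt : Nontrivial (LinearMap.range g) := Submodule.nontrivial_iff_ne_bot.2 hNbot
  have hNu : IsUniserial A (LinearMap.range g) :=
    hX.of_injective _ (LinearMap.range g).injective_subtype
  have hXnt : Nontrivial X := (LinearMap.range g).injective_subtype.nontrivial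
  -- the composition factor `V` of `X` at the top of the image of `g`
  have hV := hNu.isSimpleModule_top
  have hVnt := IsSimpleModule.nontrivial A (Top A (LinearMap.range g))
  have hSnt := IsSimpleModule.nontrivial A S
  let v : P₁ →ₗ[A] Top A (LinearMap.range g) :=
    (Module.jacobson A (LinearMap.range g)).mkQ ∘ₗ g.rangeRestrict
  have hv : Function.Surjective v :=
    (Submodule.mkQ_surjective _).comp g.surjective_rangeRestrict
  have hfv : LinearMap.ker f.rangeRestrict ≤ LinearMap.ker v := by
    rw [LinearMap.ker_rangeRestrict]
    exact hP₁.le_ker hv fun h => hf (LinearMap.ker_eq_top.1 h)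
  obtain ⟨b, hb⟩ := exists_comp_eq_of_ker_le f.surjective_rangeRestrict hfv
  have hbs : Function.Surjective b := by
    rw [← hb] at hv
    exact Function.Surjective.of_comp hv
  have hext : HasNonsplitExtension (A := A) S (Top A (LinearMap.range g)) :=
    hP₀.hasNonsplitExtension hp (LinearMap.range f).injective_subtype
      (by rw [Submodule.range_subtype, hfp]) hbs
  obtain ⟨W, hW, hWc, hs, hext'⟩ := exists_next_factor hX hNtop
    (Submodule.mkQ_surjective (Module.jacobson A (LinearMap.range g)))
  -- The top of the image of `g` is the top of P₁, so the factor above that image in `X` must be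
  -- `S`. Lifting P₀ → S to `W` then carries rad P₀ onto the image of `g`.
  obtain ⟨e⟩ := hA.equiv_left hext hext'
  have ht : ∃ t : LinearMap.range f →ₗ[A] LinearMap.range g, Function.Surjective t := by
    rw [hfp]
    exact exists_surjective_ker_of_equiv hp hX hW e
  obtain ⟨t, ht⟩ := ht
  -- Two surjections from the uniserial module P₁ onto the same Noetherian module have equal
  -- kernels, so the kernel of `g` contains that of `f`.
  have hker : LinearMap.ker f.rangeRestrict ≤ LinearMap.ker g := by
    rw [← LinearMap.ker_rangeRestrict g, hP₁.ker_eq g.surjective_rangeRestrict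
      (b := t ∘ₗ f.rangeRestrict) (ht.comp f.surjective_rangeRestrict)]
    exact LinearMap.ker_le_ker_comp _ _
  obtain ⟨g', hg'⟩ := exists_comp_eq_of_ker_le f.surjective_rangeRestrict hker
  obtain ⟨E, j, hE, hEu, hj⟩ := hA.exists_uniserial_injective hX
  obtain ⟨G, hG⟩ := Module.Injective.exists_extension (LinearMap.range f).subtype
    (LinearMap.range f).injective_subtype (j ∘ₗ g')
  have hGf : ∀ x, G (f x) = j (g x) := fun x => by
    rw [← hg']
    exact LinearMap.congr_fun hG (f.rangeRestrict x)
  -- If the image of `G` contains that of `X`, the preimage of `X` contains the maximal submodule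
  -- `ker p`. Equality would give X = im g, contrary to `hNtop`, so the preimage is all of P₀.
  have hle : LinearMap.range G ≤ LinearMap.range j := by
    rcases hEu (LinearMap.range G) (LinearMap.range j) with h | h
    · exact h
    have hpj : LinearMap.ker p ≤ (LinearMap.range j).comap G := by
      rw [← hfp]
      rintro _ ⟨x, rfl⟩
      exact ⟨g x, (hGf x).symm⟩
    rcases (isCoatom_ker_of_surjective p hp).le_iff.1 hpj with h' | h'
    · rw [LinearMap.range_eq_map, Submodule.map_le_iff_le_comap, h']
    · refine absurd (top_le_iff.1 fun x _ => ?_) hNtop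
      obtain ⟨z, hz⟩ := h ⟨x, rfl⟩
      have hz' : z ∈ (LinearMap.range j).comap G := ⟨x, hz.symm⟩
      rw [h', ← hfp] at hz'
      obtain ⟨y, rfl⟩ := hz'
      rw [hGf] at hz
      exact ⟨y, hj hz⟩
  refine ⟨(LinearEquiv.ofInjective j hj).symm.toLinearMap ∘ₗ
    G.codRestrict _ fun x => hle ⟨x, rfl⟩, LinearMap.ext fun x => ?_⟩
  simp only [LinearMap.comp_apply, LinearEquiv.coe_coe]
  rw [LinearEquiv.symm_apply_eq]
  exact Subtype.ext (hGf x)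

/-- The maps `P₁ → A` that factor through a minimal projective presentation `P₁ → P(S)` of `S` are
those with image in the radical. -/
theorem IsConnectedNakayama.mem_range_dualMap_iff (hA : IsConnectedNakayama R A)
    (hP₀ : IsUniserial A P₀) (hP₁ : IsUniserial A P₁) [Module.Projective A P₀]
    {p : P₀ →ₗ[A] S} (hp : Function.Surjective p) {f : P₁ →ₗ[A] P₀} (hf : f ≠ 0)
    (hfp : LinearMap.range f = LinearMap.ker p) (g : P₁ →ₗ[A] A) :
    g ∈ LinearMap.range (dualMap f) ↔ LinearMap.range g ≤ Module.jacobson A A := by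
  have := hA.isArtinianRing
  constructor
  · rintro ⟨h, rfl⟩
    rintro _ ⟨x, rfl⟩
    have hx : f x ∈ Module.jacobson A P₀ := by
      rw [hP₀.jacobson_eq (isCoatom_ker_of_surjective p hp), ← hfp]
      exact ⟨x, rfl⟩
    exact Module.le_comap_jacobson h hx
  · intro hg
    -- The factorization needs a uniserial target, so `g` is cut into its components along
    -- indecomposable summands of `A`, and these are summed at the end.
    have key : ∀ π ∈ AddSubmonoid.closure {π : Module.End A A | IsIdempotentElem π ∧
        IsIndecomposable A (LinearMap.range π)}, ∃ h : P₀ →ₗ[A] A, h ∘ₗ f = π ∘ₗ g := by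
      intro π hπ
      induction hπ using AddSubmonoid.closure_induction with
      | mem π hπ =>
        obtain ⟨h, hh⟩ := hA.exists_factorization hP₀ hP₁ hp hf hfp
          (hA.isUniserial_range hπ.1 hπ.2) (g := π.rangeRestrict ∘ₗ g) (fun hs => by
            have := hπ.2.1
            refine (Module.jacobson_lt_top A (LinearMap.range π)).ne (top_le_iff.1 fun y _ => ?_)
            obtain ⟨x, rfl⟩ := hs y
            exact Module.le_comap_jacobson π.rangeRestrict (hg ⟨x, rfl⟩))
        exact ⟨(LinearMap.range π).subtype ∘ₗ h, by rw [LinearMap.comp_assoc, hh]; rfl⟩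
      | zero => exact ⟨0, by rw [LinearMap.zero_comp, LinearMap.zero_comp]⟩
      | add π ρ _ _ h1 h2 =>
        obtain ⟨h1, hh1⟩ := h1
        obtain ⟨h2, hh2⟩ := h2
        exact ⟨h1 + h2, by rw [LinearMap.add_comp, LinearMap.add_comp, hh1, hh2]⟩
    obtain ⟨h, hh⟩ := key _ (one_mem_closure_indecomposable A A)
    exact ⟨h, hh⟩

/-- A map `g` not landing in rad A embeds the top of P₁ into the semisimple module A/rad A.
Splitting and lifting give ρ : A → P₁ with ρg congruent to the identity modulo rad P₁. So each `h`
differs from hρg, a right multiple of `g`, by a map into rad A. -/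
theorem IsConnectedNakayama.isSimpleModule_transpose (hA : IsConnectedNakayama R A)
    (hP₀ : IsUniserial A P₀) (hP₁ : IsUniserial A P₁) [Module.Projective A P₀]
    {p : P₀ →ₗ[A] S} (hp : Function.Surjective p) {f : P₁ →ₗ[A] P₀} (hf : f ≠ 0)
    (hfp : LinearMap.range f = LinearMap.ker p) {q : P₁ →ₗ[A] U} (hq : Function.Surjective q)
    {ι : P₁ →ₗ[A] A} (hι : ι ∉ LinearMap.range (dualMap f)) :
    IsSimpleModule Aᵐᵒᵖ (Transpose f) := by
  have := hA.isArtinianRing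
  have hr := hA.mem_range_dualMap_iff hP₀ hP₁ hp hf hfp
  have hqj := hP₁.jacobson_eq (isCoatom_ker_of_surjective q hq)
  refine isSimpleModule_iff_isCoatom.2 ⟨fun h => hι (h ▸ Submodule.mem_top), fun L hL => ?_⟩
  obtain ⟨g, hgL, hg⟩ := SetLike.exists_of_lt hL
  rw [eq_top_iff]
  intro h _
  let k : A →ₗ[A] Top A A := (Module.jacobson A A).mkQ
  have hkg : LinearMap.ker q ≤ LinearMap.ker (k ∘ₗ g) := by
    rw [← hqj]
    intro x hx
    exact (Submodule.Quotient.mk_eq_zero _).2 (Module.le_comap_jacobson g hx)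
  obtain ⟨w, hw⟩ := exists_comp_eq_of_ker_le hq hkg
  have hw0 : w ≠ 0 := by
    rintro rfl
    apply hg
    rw [hr]
    rintro _ ⟨x, rfl⟩
    exact (Submodule.Quotient.mk_eq_zero _).1 (LinearMap.congr_fun hw x).symm
  have hss : IsSemisimpleModule A (Top A A) :=
    (IsArtinian.isSemisimpleModule_iff_jacobson A _).2 (Module.jacobson_quotient_jacobson A A)
  obtain ⟨t, ht⟩ := IsSemisimpleModule.extension_property w (LinearMap.injective_of_ne_zero hw0)
    (LinearMap.id : U →ₗ[A] U)
  obtain ⟨ρ, hρ⟩ := Module.projective_lifting_property q (t ∘ₗ k) hq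
  have hρg : ∀ x, q (ρ (g x)) = q x := fun x => by
    have h1 : q (ρ (g x)) = t (k (g x)) := LinearMap.congr_fun hρ (g x)
    have h2 : k (g x) = w (q x) := (LinearMap.congr_fun hw x).symm
    rw [h1, h2]
    exact LinearMap.congr_fun ht (q x)
  have hmul : h ∘ₗ ρ ∘ₗ g = MulOpposite.op (h (ρ 1)) • g := by
    ext x
    have : g x = g x • (1 : A) := by simp
    rw [LinearMap.comp_apply, LinearMap.comp_apply, this, map_smul, map_smul]
    rfl
  have hdiff : h - h ∘ₗ ρ ∘ₗ g ∈ LinearMap.range (dualMap f) := by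
    rw [hr]
    rintro _ ⟨x, rfl⟩
    have : x - ρ (g x) ∈ Module.jacobson A P₁ := by
      rw [hqj, LinearMap.mem_ker, map_sub, hρg, sub_self]
    have h3 := Module.le_comap_jacobson h this
    simpa using h3
  have := add_mem (hL.le hdiff) (L.smul_mem (MulOpposite.op (h (ρ 1))) hgL)
  rwa [← hmul, sub_add_cancel] at this

/-- In a minimal projective presentation `P₁ → P₀ → S` over a Nakayama algebra, `P₁` is a projective
cover of `U` if there is a nonsplit extension of `S` by `U`. -/
theorem IsConnectedNakayama.exists_isProjectiveCover (hA : IsConnectedNakayama R A)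
    (hext : HasNonsplitExtension (A := A) S U) {p : P₀ →ₗ[A] S} {f : P₁ →ₗ[A] P₀}
    (hfp : IsMinimalProjectivePresentation f p) :
    ∃ q : P₁ →ₗ[A] U, IsProjectiveCover q ∧ f ≠ 0 := by
  obtain ⟨hp, hr, hf⟩ := hfp
  have hP₀ := (hA.of_isProjectiveCover hp).2
  have := hp.1
  have hb : ∃ b : LinearMap.range f →ₗ[A] U, Function.Surjective b := by
    rw [hr]
    exact hext.exists_surjective_ker hp.2.1
  obtain ⟨b, hb⟩ := hb
  have hq := hf.comp_of_isUniserial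
    (hP₀.of_injective _ (LinearMap.range f).injective_subtype) hb
  refine ⟨_, hq, ?_⟩
  rintro rfl
  have := IsSimpleModule.nontrivial A U
  obtain ⟨u, hu⟩ := exists_ne (0 : U)
  obtain ⟨x, rfl⟩ := hq.2.1 u
  apply hu
  have : (0 : P₁ →ₗ[A] P₀).rangeRestrict x = 0 := Subtype.ext rfl
  rw [LinearMap.comp_apply, this, map_zero]

/-- A projective cover of a simple module is a direct summand of the regular module. -/
theorem IsProjectiveCover.exists_split {q : P₁ →ₗ[A] U} (hq : IsProjectiveCover q) :
    ∃ (ρ : A →ₗ[A] P₁) (ι : P₁ →ₗ[A] A), ∀ x, ρ (ι x) = x := by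
  have := hq.1
  have := IsSimpleModule.nontrivial A U
  obtain ⟨u, hu⟩ := exists_ne (0 : U)
  obtain ⟨ρ, hρ⟩ := Module.projective_lifting_property q (LinearMap.toSpanSingleton A U u) hq.2.1
  have hρs : Function.Surjective ρ := hq.surjective_of_comp (by
    rw [hρ]
    exact IsSimpleModule.toSpanSingleton_surjective A hu)
  obtain ⟨ι, hι⟩ := Module.projective_lifting_property ρ LinearMap.id hρs
  exact ⟨ρ, ι, fun x => LinearMap.congr_fun hι x⟩

theorem finite_transpose [IsArtinianRing R] [Module.Finite R A] {ρ : A →ₗ[A] P₁}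
    (hρ : Function.Surjective ρ) (f : P₁ →ₗ[A] P₀) : Module.Finite R (Transpose f) := by
  have hfin : Module.Finite R (P₁ →ₗ[A] A) := by
    let ev : (P₁ →ₗ[A] A) →ₗ[R] A :=
      { toFun := fun g => g (ρ 1)
        map_add' := fun _ _ => rfl
        map_smul' := fun _ _ => rfl }
    refine Module.Finite.of_injective ev fun g h hgh => LinearMap.ext fun x => ?_
    obtain ⟨a, rfl⟩ := hρ x
    have : a = a • (1 : A) := by simp
    rw [this, map_smul, map_smul, map_smul]
    exact congrArg (a • ·) hgh
  exact Module.Finite.quotient R _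

/-- The Auslander-Reiten translate of a simple module `S` over a Nakayama algebra is the simple
module `U` for which there is a nonsplit extension of `S` by `U`. -/
theorem IsConnectedNakayama.equiv_of_isDual (hA : IsConnectedNakayama R A)
    (hext : HasNonsplitExtension (A := A) S U) {p : P₀ →ₗ[A] S} {f : P₁ →ₗ[A] P₀}
    (hfp : IsMinimalProjectivePresentation f p) {Y : Type u} [AddCommGroup Y] [Module A Y]
    (hY : IsDual R (A := A) (Transpose f) Y) : Nonempty (Y ≃ₗ[A] U) := by
  have := hA.artinian
  have := hA.finite
  have := hA.isArtinianRing
  obtain ⟨q, hq, hf0⟩ := hA.exists_isProjectiveCover hext hfp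
  obtain ⟨hp, hr, -⟩ := hfp
  have hP₀ := (hA.of_isProjectiveCover hp).2
  have := hp.1
  obtain ⟨_, hP₁⟩ := hA.of_isProjectiveCover hq
  obtain ⟨ρ, ι, hι⟩ := hq.exists_split
  have hιr : ι ∉ LinearMap.range (dualMap f) := by
    rw [hA.mem_range_dualMap_iff hP₀ hP₁ hp.2.1 hf0 hr]
    intro h
    have := IsSimpleModule.nontrivial A U
    have : Nontrivial P₁ := hq.2.1.nontrivial
    refine (Module.jacobson_lt_top A P₁).ne (top_le_iff.1 fun x _ => ?_)
    rw [← hι x]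
    exact Module.le_comap_jacobson ρ (h ⟨x, rfl⟩)
  have := hA.isSimpleModule_transpose hP₀ hP₁ hp.2.1 hf0 hr hq.2.1 hιr
  have hfin : Module.Finite R (Transpose f) := finite_transpose (fun x => ⟨ι x, hι x⟩) f
  have hYs := hY.isSimpleModule
  obtain ⟨J, i, hi, e, he⟩ := hY
  have hιne : (LinearMap.range (dualMap f)).mkQ ι ≠ 0 := fun h =>
    hιr ((Submodule.Quotient.mk_eq_zero _).1 h)
  obtain ⟨φ, hφ⟩ := exists_dual_apply_ne_zero hi hιne
  obtain ⟨y, rfl⟩ := e.surjective φ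
  -- Right multiplication by ι(ρ(1)) fixes `ι`, so a functional nonzero on the class of `ι` stays
  -- nonzero after acting by that element. This yields a nonzero map P₁ → Y, and `Y` is simple.
  have hne : LinearMap.toSpanSingleton A Y y ∘ₗ ι ≠ 0 := by
    intro h
    apply hφ
    have h1 : ι (ρ 1) • y = 0 := LinearMap.congr_fun h (ρ 1)
    have h2 : MulOpposite.op (ι (ρ 1)) • ι = ι := by
      ext x
      change ι x * ι (ρ 1) = ι x
      rw [← smul_eq_mul, ← map_smul, ← map_smul, smul_eq_mul, mul_one, hι]
    have h3 := he (ι (ρ 1)) y ((LinearMap.range (dualMap f)).mkQ ι)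
    rw [h1, map_zero, LinearMap.zero_apply, ← map_smul, h2] at h3
    exact h3.symm
  exact hP₁.equiv_of_quotients (LinearMap.surjective_of_ne_zero hne) hq.2.1

end Translate

end Nakayama

section Artin

variable {R A : Type u} [CommRing R] [Ring A] [Algebra R A]
variable {S U Y Y' : Type u} [AddCommGroup S] [Module A S] [IsSimpleModule A S] [AddCommGroup U]
  [Module A U] [IsSimpleModule A U] [AddCommGroup Y] [Module A Y] [AddCommGroup Y'] [Module A Y']

theorem IsDual.congr {X : Type u} [AddCommGroup X] [Module R X] [Module Aᵐᵒᵖ X]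
    [IsScalarTower R Aᵐᵒᵖ X] (h : IsDual R (A := A) X Y) (e : Y' ≃ₗ[A] Y) :
    IsDual R (A := A) X Y' := by
  obtain ⟨J, i, hi, d, hd⟩ := h
  refine ⟨J, i, hi, e.toAddEquiv.trans d, fun a y x => ?_⟩
  change d (e (a • y)) x = d (e y) _
  rw [map_smul, hd]

theorem IsUniserial.isProjectiveCover_of_surjective {P K : Type u} [AddCommGroup P] [Module A P]
    [AddCommGroup K] [Module A K] [Nontrivial K] [Module.Projective A P] (hP : IsUniserial A P)
    {q : P →ₗ[A] K} (hq : Function.Surjective q) : IsProjectiveCover q := by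
  refine ⟨inferInstance, hq, fun N hN => ?_⟩
  rcases hP N (LinearMap.ker q) with h | h
  · rw [sup_eq_right.2 h, LinearMap.ker_eq_top] at hN
    obtain ⟨x, y, hxy⟩ := exists_pair_ne K
    obtain ⟨x, rfl⟩ := hq x
    obtain ⟨y, rfl⟩ := hq y
    exact absurd (by rw [hN]; rfl) hxy
  · rwa [sup_eq_left.2 h] at hN

theorem IsConnectedNakayama.exists_isMinimalProjectivePresentation
    (hA : IsConnectedNakayama R A) (hext : HasNonsplitExtension (A := A) S U) :
    ∃ (P₁ P₀ : ModuleCat.{u} A) (f : P₁ →ₗ[A] P₀) (p : P₀ →ₗ[A] S),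
      IsMinimalProjectivePresentation f p := by
  obtain ⟨P₀, p, -, hP₀, hp⟩ := hA.exists_projective S
  obtain ⟨P₁, q, -, hP₁, hq⟩ := hA.exists_projective U
  have := hp.1
  have := hq.1
  obtain ⟨b, hb⟩ := hext.exists_surjective_ker hp.2.1
  obtain ⟨f, hf⟩ := Module.projective_lifting_property b q hb
  have := IsSimpleModule.nontrivial A U
  have hnt : Nontrivial (LinearMap.ker p) := hb.nontrivial
  have hfs : Function.Surjective f := by
    refine (hP₀.of_injective _ (LinearMap.ker p).injective_subtype).surjective_of_comp_ne_zero hb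
      fun h => ?_
    obtain ⟨u, hu⟩ := exists_ne (0 : U)
    obtain ⟨x, rfl⟩ := hq.2.1 u
    exact hu (by rw [← hf, h]; rfl)
  have hr : LinearMap.range ((LinearMap.ker p).subtype ∘ₗ f) = LinearMap.ker p := by
    rw [LinearMap.range_comp, LinearMap.range_eq_top.2 hfs, Submodule.map_top,
      Submodule.range_subtype]
  refine ⟨P₁, P₀, (LinearMap.ker p).subtype ∘ₗ f, p, hp, hr, ?_⟩
  have : Nontrivial (LinearMap.range ((LinearMap.ker p).subtype ∘ₗ f)) := by rwa [hr]
  exact hP₁.isProjectiveCover_of_surjective (LinearMap.surjective_rangeRestrict _)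

theorem IsConnectedNakayama.isARTranslate_iff (hA : IsConnectedNakayama R A)
    (hext : HasNonsplitExtension (A := A) S U) :
    IsARTranslate R (A := A) S Y ↔ Nonempty (Y ≃ₗ[A] U) := by
  constructor
  · rintro ⟨P₁, P₀, f, p, hfp, hY⟩
    exact hA.equiv_of_isDual hext hfp hY
  · rintro ⟨e⟩
    obtain ⟨P₁, P₀, f, p, hfp⟩ := hA.exists_isMinimalProjectivePresentation hext
    obtain ⟨Z, hZ⟩ := exists_isDual R (A := A) (Transpose f)
    obtain ⟨e'⟩ := hA.equiv_of_isDual hext hfp hZ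
    exact ⟨P₁, P₀, f, p, hfp, hZ.congr (e ≪≫ₗ e'.symm)⟩

end Artin

/-! ### Isomorphism classes of simple modules -/

section Classes

variable {A : Type u} [Ring A]

/-- The isomorphism class of a simple module. -/
def SimpleClass.mk (M : Type u) [AddCommGroup M] [Module A M] [h : IsSimpleModule A M] :
    SimpleClass A :=
  Quotient.mk (simpleSetoid A) ⟨ModuleCat.of A M, h⟩

instance SimpleClass.isSimpleModule_rep (S : SimpleClass A) : IsSimpleModule A S.rep :=
  (Quotient.out S).2

variable {M N : Type u} [AddCommGroup M] [Module A M] [IsSimpleModule A M] [AddCommGroup N]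
  [Module A N] [IsSimpleModule A N]

theorem SimpleClass.mk_eq_mk_iff : mk (A := A) M = mk N ↔ Nonempty (M ≃ₗ[A] N) :=
  Quotient.eq (r := simpleSetoid A)

theorem SimpleClass.mk_rep (S : SimpleClass A) : mk (A := A) S.rep = S :=
  Quotient.out_eq S

theorem SimpleClass.nonempty_rep_mk_equiv : Nonempty ((mk (A := A) M).rep ≃ₗ[A] M) :=
  SimpleClass.mk_eq_mk_iff.1 (mk_rep _)

/-- The relation `Ext¹(S, T) ≠ 0` on classes of simple modules. -/
def SimpleClass.Ext (S T : SimpleClass A) : Prop :=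
  HasNonsplitExtension (A := A) S.rep T.rep

theorem SimpleClass.ext_mk_iff :
    (mk (A := A) M).Ext (mk N) ↔ HasNonsplitExtension (A := A) M N := by
  obtain ⟨e⟩ := nonempty_rep_mk_equiv (A := A) (M := M)
  obtain ⟨d⟩ := nonempty_rep_mk_equiv (A := A) (M := N)
  exact ⟨fun h => h.congr e d, fun h => h.congr e.symm d.symm⟩

/-- The relation `T = τ̃ S` on classes of simple modules. -/
def SimpleClass.Tau (S T : SimpleClass A) : Prop :=
  (¬ Module.Projective A S.rep ∧ S.Ext T) ∨
    (Module.Projective A S.rep ∧ Module.Injective A T.rep)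

theorem SimpleClass.projective_rep_mk_iff :
    Module.Projective A (mk (A := A) M).rep ↔ Module.Projective A M := by
  obtain ⟨e⟩ := nonempty_rep_mk_equiv (A := A) (M := M)
  exact ⟨fun _ => Module.Projective.of_equiv e, fun _ => Module.Projective.of_equiv e.symm⟩

theorem SimpleClass.injective_rep_mk_iff :
    Module.Injective A (mk (A := A) M).rep ↔ Module.Injective A M := by
  obtain ⟨e⟩ := nonempty_rep_mk_equiv (A := A) (M := M)
  exact ⟨fun _ => Module.Injective.of_linearEquiv e, fun _ => Module.Injective.of_linearEquiv e.symm⟩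

end Classes

/-! ### Connectedness, and bijectivity of the translate on classes -/

section Connected

variable {R A : Type u} [CommRing R] [Ring A] [Algebra R A]

open SimpleClass (nonempty_rep_mk_equiv mk_eq_mk_iff mk_rep ext_mk_iff projective_rep_mk_iff
  injective_rep_mk_iff)

theorem IsConnectedNakayama.isTauTilde_iff (hA : IsConnectedNakayama R A) {M N : Type u}
    [AddCommGroup M] [Module A M] [IsSimpleModule A M] [AddCommGroup N] [Module A N]
    [IsSimpleModule A N] : IsTauTilde R (A := A) M N ↔ (SimpleClass.mk (A := A) M).Tau (SimpleClass.mk N) := by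
  rw [IsTauTilde, SimpleClass.Tau, projective_rep_mk_iff, injective_rep_mk_iff, ext_mk_iff]
  refine or_congr (and_congr_right fun hM => ?_) (and_congr_right fun _ => and_iff_right ‹_›)
  obtain ⟨U, hU, hext⟩ := hA.exists_right hM
  rw [hA.isARTranslate_iff hext]
  exact ⟨fun ⟨e⟩ => hext.congr (LinearEquiv.refl A M) e.symm, fun h => hA.equiv_right h hext⟩

section Blocks

variable {C : Set (SimpleClass A)}
variable {M N V V' : Type u} [AddCommGroup M] [Module A M] [AddCommGroup N] [Module A N]
  [AddCommGroup V] [Module A V] [IsSimpleModule A V] [AddCommGroup V'] [Module A V']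
  [IsSimpleModule A V']

/-- Climb from `L` to `M` one composition factor at a time; consecutive tops are linked by a
nonsplit extension, so membership in `C` never changes. -/
theorem mem_iff_of_submodule (hC : ∀ S T : SimpleClass A, S.Ext T → (S ∈ C ↔ T ∈ C))
    [IsArtinian A M] [IsNoetherian A M] (hM : IsUniserial A M) {s : M →ₗ[A] V}
    (hs : Function.Surjective s) (L : Submodule A M) {b : L →ₗ[A] V'}
    (hb : Function.Surjective b) : SimpleClass.mk (A := A) V' ∈ C ↔ SimpleClass.mk (A := A) V ∈ C := by
  induction L using WellFoundedGT.induction generalizing V' with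
  | ind L ih =>
    by_cases hL : L = ⊤
    · subst hL
      obtain ⟨e⟩ := hM.equiv_of_quotients (q := b ∘ₗ Submodule.topEquiv.symm.toLinearMap) hs
        (hb.comp (LinearEquiv.surjective _))
      rw [mk_eq_mk_iff.2 ⟨e⟩]
    · obtain ⟨W, hLW, hcov, hsimple, hext⟩ := exists_next_factor hM hL hb
      rw [← hC _ _ (ext_mk_iff.2 hext)]
      exact ih W hcov.lt (Submodule.mkQ_surjective _)

theorem mem_iff_of_ne_zero (hC : ∀ S T : SimpleClass A, S.Ext T → (S ∈ C ↔ T ∈ C))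
    [IsArtinian A M] [IsNoetherian A M] (hM : IsUniserial A M) (hN : IsUniserial A N)
    {s : M →ₗ[A] V} (hs : Function.Surjective s) {t : N →ₗ[A] V'} (ht : Function.Surjective t)
    {f : N →ₗ[A] M} (hf : f ≠ 0) : SimpleClass.mk (A := A) V' ∈ C ↔ SimpleClass.mk (A := A) V ∈ C := by
  have hle : LinearMap.ker f.rangeRestrict ≤ LinearMap.ker t := by
    rw [LinearMap.ker_rangeRestrict]
    exact hN.le_ker ht fun h => hf (LinearMap.ker_eq_top.1 h)
  obtain ⟨b, hb⟩ := exists_comp_eq_of_ker_le f.surjective_rangeRestrict hle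
  refine mem_iff_of_submodule hC hM hs (LinearMap.range f) (b := b) ?_
  rw [← hb] at ht
  exact Function.Surjective.of_comp ht

end Blocks

theorem mul_mul_eq_zero_of_mem_closure {E : Type*} [Semiring E] {s t : Set E}
    (h : ∀ a ∈ s, ∀ x : E, ∀ b ∈ t, a * x * b = 0) {a b : E} (ha : a ∈ AddSubmonoid.closure s)
    (hb : b ∈ AddSubmonoid.closure t) (x : E) : a * x * b = 0 := by
  induction ha using AddSubmonoid.closure_induction with
  | mem a ha =>
    induction hb using AddSubmonoid.closure_induction with
    | mem b hb => exact h a ha x b hb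
    | zero => rw [mul_zero]
    | add b c _ _ h1 h2 => rw [mul_add, h1, h2, add_zero]
  | zero => rw [zero_mul, zero_mul]
  | add a c _ _ h1 h2 => rw [add_mul, add_mul, h1, h2, add_zero]

/-- Over a connected Nakayama algebra, a set of classes of simple modules that is closed under
nonsplit extensions in both directions is empty or contains every class. -/
theorem IsConnectedNakayama.forall_mem_or_forall_notMem (hA : IsConnectedNakayama R A)
    {C : Set (SimpleClass A)} (hC : ∀ S T : SimpleClass A, S.Ext T → (S ∈ C ↔ T ∈ C)) :
    (∀ S, S ∈ C) ∨ ∀ S, S ∉ C := by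
  have := hA.isArtinianRing
  let s : Set (SimpleClass A) → Set (Module.End A A) := fun D => {π | IsIdempotentElem π ∧
    IsIndecomposable A (LinearMap.range π) ∧ ∀ (V : SimpleClass A) (v : LinearMap.range π →ₗ[A] V.rep),
      Function.Surjective v → V ∈ D}
  have htop : ∀ π : Module.End A A, IsIdempotentElem π → IsIndecomposable A (LinearMap.range π) →
      IsUniserial A (LinearMap.range π) ∧ ∃ (V : SimpleClass A) (v : LinearMap.range π →ₗ[A] V.rep),
        Function.Surjective v := by
    intro π h1 h2
    have hu := hA.isUniserial_range h1 h2
    have := h2.1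
    have := hu.isSimpleModule_top
    obtain ⟨e⟩ := nonempty_rep_mk_equiv (A := A) (M := Top A (LinearMap.range π))
    exact ⟨hu, SimpleClass.mk (Top A (LinearMap.range π)), e.symm.toLinearMap ∘ₗ Submodule.mkQ _,
      e.symm.surjective.comp (Submodule.mkQ_surjective _)⟩
  have hone : (1 : Module.End A A) ∈ AddSubmonoid.closure (s C ∪ s Cᶜ) := by
    refine AddSubmonoid.closure_mono ?_ (one_mem_closure_indecomposable A A)
    rintro π ⟨h1, h2⟩
    obtain ⟨hu, V, v, hv⟩ := htop π h1 h2
    have huniq : ∀ (W : SimpleClass A) (w : LinearMap.range π →ₗ[A] W.rep),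
        Function.Surjective w → W = V := fun W w hw => by
      rw [← mk_rep W, ← mk_rep V]
      exact mk_eq_mk_iff.2 (hu.equiv_of_quotients hw hv)
    by_cases hVC : V ∈ C
    · exact Or.inl ⟨h1, h2, fun W w hw => huniq W w hw ▸ hVC⟩
    · exact Or.inr ⟨h1, h2, fun W w hw => huniq W w hw ▸ hVC⟩
  have horth : ∀ π ρ φ : Module.End A A, (π ∈ s C ∧ ρ ∈ s Cᶜ ∨ π ∈ s Cᶜ ∧ ρ ∈ s C) →
      π * φ * ρ = 0 := by
    intro π ρ φ h
    by_contra hne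
    have hidem : (IsIdempotentElem π ∧ IsIndecomposable A (LinearMap.range π)) ∧
        IsIdempotentElem ρ ∧ IsIndecomposable A (LinearMap.range ρ) := by
      rcases h with ⟨h, h'⟩ | ⟨h, h'⟩ <;> exact ⟨⟨h.1, h.2.1⟩, h'.1, h'.2.1⟩
    obtain ⟨hu, V, v, hv⟩ := htop π hidem.1.1 hidem.1.2
    obtain ⟨hu', V', v', hv'⟩ := htop ρ hidem.2.1 hidem.2.2
    have hf : π.rangeRestrict ∘ₗ φ ∘ₗ (LinearMap.range ρ).subtype ≠ 0 := by
      refine fun h0 => hne (LinearMap.ext fun x => ?_)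
      exact congrArg Subtype.val (LinearMap.congr_fun h0 (ρ.rangeRestrict x))
    have hiff := mem_iff_of_ne_zero hC hu hu' hv hv' hf
    rw [mk_rep, mk_rep] at hiff
    rcases h with ⟨h, h'⟩ | ⟨h, h'⟩
    · exact h'.2.2 V' v' hv' (hiff.2 (h.2.2 V v hv))
    · exact h.2.2 V v hv (hiff.1 (h'.2.2 V' v' hv'))
  have hquot : ∀ D : Set (SimpleClass A), (1 : Module.End A A) ∈ AddSubmonoid.closure (s D) →
      ∀ S, S ∈ D := by
    intro D hD S
    have := IsSimpleModule.nontrivial A S.rep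
    obtain ⟨x, hx⟩ := exists_ne (0 : S.rep)
    have hφ : LinearMap.toSpanSingleton A S.rep x ≠ 0 := fun h => hx (by
      simpa using LinearMap.congr_fun h 1)
    obtain ⟨π, hπ, hne⟩ := exists_comp_ne_zero_of_one_mem_closure hD hφ
    refine hπ.2.2 S (LinearMap.toSpanSingleton A S.rep x ∘ₗ (LinearMap.range π).subtype)
      (LinearMap.surjective_of_ne_zero fun h => hne (LinearMap.ext fun y => ?_))
    exact LinearMap.congr_fun h (π.rangeRestrict y)
  rw [AddSubmonoid.closure_union, AddSubmonoid.mem_sup] at hone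
  obtain ⟨ε, hε, ε', hε', hsum⟩ := hone
  have h1 : ∀ φ : Module.End A A, ε * φ * ε' = 0 :=
    mul_mul_eq_zero_of_mem_closure (fun a ha x b hb => horth a b x (Or.inl ⟨ha, hb⟩)) hε hε'
  have h2 : ∀ φ : Module.End A A, ε' * φ * ε = 0 :=
    mul_mul_eq_zero_of_mem_closure (fun a ha x b hb => horth a b x (Or.inr ⟨ha, hb⟩)) hε' hε
  -- The part of the identity supported on `C` is thus a central idempotent endomorphism; its value
  -- at 1 is a central idempotent of `A`.
  have h3 : ∀ φ : Module.End A A, ε * φ = φ * ε := fun φ => by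
    calc ε * φ = ε * φ * (ε + ε') := by rw [hsum, mul_one]
      _ = (ε + ε') * φ * ε := by rw [mul_add, h1, add_mul, add_mul, h2]
      _ = φ * ε := by rw [hsum, one_mul]
  have h4 : ε * ε = ε := by
    have h := h1 1
    have : ε * (ε + ε') = ε * ε + ε * 1 * ε' := by rw [mul_one, mul_add]
    rwa [hsum, h, add_zero, mul_one, eq_comm] at this
  have happ : ∀ x, ε x = x * ε 1 := fun x => by
    rw [← smul_eq_mul, ← map_smul, smul_eq_mul, mul_one]
  have hidem : IsIdempotentElem (ε 1) := by
    have := LinearMap.congr_fun h4 1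
    rw [Module.End.mul_apply, happ] at this
    exact this
  have hcent : ∀ a, ε 1 * a = a * ε 1 := fun a => by
    have h := LinearMap.congr_fun (h3 (LinearMap.toSpanSingleton A A a)) 1
    simp only [Module.End.mul_apply, LinearMap.toSpanSingleton_apply, smul_eq_mul, one_mul] at h
    rw [← h, happ a]
  rcases hA.connected _ hidem hcent with h | h
  · right
    have hε0 : ε = 0 := LinearMap.ext fun x => by rw [happ, h, mul_zero]; rfl
    rw [hε0, zero_add] at hsum
    exact hquot Cᶜ (hsum ▸ hε')
  · left
    have hε1 : ε = 1 := LinearMap.ext fun x => by rw [happ, h, mul_one]; rfl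
    exact hquot C (hε1 ▸ hε)

/-- Every simple module is a quotient of one of finitely many uniserial summands of `A`, and each of
these has only one simple quotient. -/
theorem IsConnectedNakayama.finite_simpleClass (hA : IsConnectedNakayama R A) :
    Finite (SimpleClass A) := by
  have := hA.isArtinianRing
  obtain ⟨l, hl, hsum⟩ := AddSubmonoid.exists_list_of_mem_closure
    (one_mem_closure_indecomposable A A)
  have hone : (1 : Module.End A A) ∈ AddSubmonoid.closure {π | π ∈ l} := by
    rw [← hsum]
    exact AddSubmonoid.list_sum_mem _ fun π hπ => AddSubmonoid.subset_closure hπ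
  have key : ∀ S : SimpleClass A, ∃ π : {π // π ∈ l}, ∃ v : LinearMap.range π.1 →ₗ[A] S.rep,
      Function.Surjective v := by
    intro S
    have := IsSimpleModule.nontrivial A S.rep
    obtain ⟨x, hx⟩ := exists_ne (0 : S.rep)
    have hφ : LinearMap.toSpanSingleton A S.rep x ≠ 0 := fun h => hx (by
      simpa using LinearMap.congr_fun h 1)
    obtain ⟨π, hπ, hne⟩ := exists_comp_ne_zero_of_one_mem_closure hone hφ
    refine ⟨⟨π, hπ⟩, LinearMap.toSpanSingleton A S.rep x ∘ₗ (LinearMap.range π).subtype,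
      LinearMap.surjective_of_ne_zero fun h => hne (LinearMap.ext fun y => ?_)⟩
    exact LinearMap.congr_fun h (π.rangeRestrict y)
  choose F hF using key
  have : Finite {π // π ∈ l} := List.finite_toSet l
  refine Finite.of_injective F fun S T hST => ?_
  obtain ⟨v, hv⟩ := hF S
  have hT := hF T
  rw [← hST] at hT
  obtain ⟨w, hw⟩ := hT
  rw [← mk_rep S, ← mk_rep T]
  obtain ⟨h1, h2⟩ := hl _ (F S).2
  exact mk_eq_mk_iff.2 ((hA.isUniserial_range h1 h2).equiv_of_quotients hv hw)

section Tau

variable {S S' T T' : SimpleClass A}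

theorem SimpleClass.Ext.eq_right (hA : IsConnectedNakayama R A) (h : S.Ext T) (h' : S.Ext T') :
    T = T' := by
  rw [← mk_rep T, ← mk_rep T']
  exact mk_eq_mk_iff.2 (hA.equiv_right h h')

theorem SimpleClass.Ext.eq_left (hA : IsConnectedNakayama R A) (h : S.Ext T) (h' : S'.Ext T) :
    S = S' := by
  rw [← mk_rep S, ← mk_rep S']
  exact mk_eq_mk_iff.2 (hA.equiv_left h h')

theorem IsConnectedNakayama.exists_ext_right (hA : IsConnectedNakayama R A)
    (h : ¬ Module.Projective A S.rep) : ∃ T : SimpleClass A, S.Ext T := by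
  obtain ⟨U, hU, hext⟩ := hA.exists_right h
  refine ⟨SimpleClass.mk U, ?_⟩
  rw [← mk_rep S]
  exact ext_mk_iff.2 hext

theorem IsConnectedNakayama.exists_ext_left (hA : IsConnectedNakayama R A)
    (h : ¬ Module.Injective A T.rep) : ∃ S : SimpleClass A, S.Ext T := by
  obtain ⟨U, hU, hext⟩ := hA.exists_left h
  refine ⟨SimpleClass.mk U, ?_⟩
  rw [← mk_rep T]
  exact ext_mk_iff.2 hext

-- The classes with a path of extensions down to `S` form a block: `S` has no successor and
-- successors are unique. By connectedness the block contains `S'`, which has no successor either,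
-- so the path has length zero.
open Relation in
theorem IsConnectedNakayama.eq_of_projective (hA : IsConnectedNakayama R A)
    (h : Module.Projective A S.rep) (h' : Module.Projective A S'.rep) : S' = S := by
  have hno : ∀ {X Y : SimpleClass A}, Module.Projective A X.rep → ¬ X.Ext Y :=
    fun hX hXY => hXY.not_projective hX
  have hC : ∀ X Y : SimpleClass A, X.Ext Y →
      (X ∈ {X | ReflTransGen SimpleClass.Ext X S} ↔ Y ∈ {X | ReflTransGen SimpleClass.Ext X S}) := by
    refine fun X Y hXY => ⟨fun hX => ?_, fun hY => ReflTransGen.head hXY hY⟩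
    rcases ReflTransGen.cases_head hX with rfl | ⟨c, h1, h2⟩
    · exact absurd hXY (hno h)
    · exact (h1.eq_right hA hXY) ▸ h2
  rcases hA.forall_mem_or_forall_notMem hC with hall | hnone
  · rcases ReflTransGen.cases_head (hall S') with h1 | ⟨c, h1, -⟩
    · exact h1
    · exact absurd h1 (hno h')
  · exact absurd ReflTransGen.refl (hnone S)

open Relation in
theorem IsConnectedNakayama.eq_of_injective (hA : IsConnectedNakayama R A)
    (h : Module.Injective A T.rep) (h' : Module.Injective A T'.rep) : T' = T := by
  have hno : ∀ {X Y : SimpleClass A}, Module.Injective A Y.rep → ¬ X.Ext Y :=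
    fun hY hXY => hXY.not_injective hY
  have hC : ∀ X Y : SimpleClass A, X.Ext Y →
      (X ∈ {X | ReflTransGen SimpleClass.Ext T X} ↔ Y ∈ {X | ReflTransGen SimpleClass.Ext T X}) := by
    refine fun X Y hXY => ⟨fun hX => ReflTransGen.tail hX hXY, fun hY => ?_⟩
    rcases ReflTransGen.cases_tail hY with rfl | ⟨c, h1, h2⟩
    · exact absurd hXY (hno h)
    · exact (h2.eq_left hA hXY) ▸ h1
  rcases hA.forall_mem_or_forall_notMem hC with hall | hnone
  · rcases ReflTransGen.cases_tail (hall T') with h1 | ⟨c, -, h1⟩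
    · exact h1
    · exact absurd h1 (hno h')
  · exact absurd ReflTransGen.refl (hnone T)

/-- Without a projective simple, "next factor down" is an injective self-map of a finite set, hence
surjective, and an injective simple is never hit. The converse is dual. -/
theorem IsConnectedNakayama.exists_injective_iff (hA : IsConnectedNakayama R A) :
    (∃ T : SimpleClass A, Module.Injective A T.rep) ↔
      ∃ S : SimpleClass A, Module.Projective A S.rep := by
  have := hA.finite_simpleClass
  constructor
  · rintro ⟨T, hT⟩
    by_contra! h
    choose f hf using fun S => hA.exists_ext_right (h S)
    have hinj : Function.Injective f := fun S S' h => (hf S).eq_left hA (by rw [h]; exact hf S')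
    obtain ⟨S, hS⟩ := Finite.surjective_of_injective hinj T
    exact (hf S).not_injective (by rw [hS]; exact hT)
  · rintro ⟨S, hS⟩
    by_contra! h
    choose f hf using fun T => hA.exists_ext_left (h T)
    have hinj : Function.Injective f := fun T T' h => (hf T).eq_right hA (by rw [h]; exact hf T')
    obtain ⟨T, hT⟩ := Finite.surjective_of_injective hinj S
    exact (hf T).not_projective (by rw [hT]; exact hS)

/-- The map `τ̃` is well defined. -/
theorem IsConnectedNakayama.existsUnique_tau_right (hA : IsConnectedNakayama R A)
    (S : SimpleClass A) : ∃! T, S.Tau T := by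
  by_cases hS : Module.Projective A S.rep
  · obtain ⟨T, hT⟩ := hA.exists_injective_iff.2 ⟨S, hS⟩
    refine ⟨T, Or.inr ⟨hS, hT⟩, fun T' hT' => ?_⟩
    rcases hT' with ⟨h, -⟩ | ⟨-, h⟩
    · exact absurd hS h
    · exact hA.eq_of_injective hT h
  · obtain ⟨T, hT⟩ := hA.exists_ext_right hS
    refine ⟨T, Or.inl ⟨hS, hT⟩, fun T' hT' => ?_⟩
    rcases hT' with ⟨-, h⟩ | ⟨h, -⟩
    · exact h.eq_right hA hT
    · exact absurd h hS

/-- The map `τ̃` is a bijection. -/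
theorem IsConnectedNakayama.existsUnique_tau_left (hA : IsConnectedNakayama R A)
    (T : SimpleClass A) : ∃! S, SimpleClass.Tau S T := by
  by_cases hT : Module.Injective A T.rep
  · obtain ⟨S, hS⟩ := hA.exists_injective_iff.1 ⟨T, hT⟩
    refine ⟨S, Or.inr ⟨hS, hT⟩, fun S' hS' => ?_⟩
    rcases hS' with ⟨-, h⟩ | ⟨h, -⟩
    · exact absurd hT h.not_injective
    · exact hA.eq_of_projective hS h
  · obtain ⟨S, hS⟩ := hA.exists_ext_left hT
    refine ⟨S, Or.inl ⟨hS.not_projective, hS⟩, fun S' hS' => ?_⟩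
    rcases hS' with ⟨-, h⟩ | ⟨-, h⟩
    · exact h.eq_left hA hS
    · exact absurd h hT

end Tau

end Connected

/-! ### The maps `γ` and `ψ`, and black vertices -/

section Maps

variable {R A : Type u} [CommRing R] [Ring A] [Algebra R A]

open SimpleClass (nonempty_rep_mk_equiv mk_eq_mk_iff mk_rep ext_mk_iff)

variable {S T : SimpleClass A}
variable {P I L V : Type u} [AddCommGroup P] [Module A P] [AddCommGroup I] [Module A I]
  [AddCommGroup L] [Module A L] [IsSimpleModule A L] [AddCommGroup V] [Module A V]
  [IsSimpleModule A V]

theorem IsConnectedNakayama.isGamma_iff (hA : IsConnectedNakayama R A) {p : P →ₗ[A] S.rep}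
    (hp : IsProjectiveCover p) {l : L →ₗ[A] P} (hl : Function.Injective l) :
    IsGamma R S T ↔ (SimpleClass.mk (A := A) L).Tau T := by
  have := hA.isArtinianRing
  have := IsSimpleModule.nontrivial A S.rep
  have key : ∀ (Q : ModuleCat.{u} A) (q : Q →ₗ[A] S.rep), IsProjectiveCover q →
      (IsTauTilde R (A := A) (socle A Q) T.rep ↔ (SimpleClass.mk (A := A) L).Tau T) := by
    intro Q q hq
    obtain ⟨hQf, hQ⟩ := hA.of_isProjectiveCover hq
    have : Nontrivial Q := hq.2.1.nontrivial
    have := hQ.isSimpleModule_socle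
    obtain ⟨e, -⟩ := hp.exists_equiv hq
    rw [hA.isTauTilde_iff, mk_rep, mk_eq_mk_iff.2 (hQ.equiv_of_submodules
      (socle A Q).injective_subtype (j := e.toLinearMap ∘ₗ l) (e.injective.comp hl))]
  exact ⟨fun ⟨Q, q, hq, h⟩ => (key Q q hq).1 h,
    fun h => ⟨ModuleCat.of A P, p, hp, (key _ p hp).2 h⟩⟩

theorem IsConnectedNakayama.isPsi_iff (hA : IsConnectedNakayama R A) {i : S.rep →ₗ[A] I}
    (hi : IsInjectiveEnvelope i) {v : I →ₗ[A] V} (hv : Function.Surjective v) :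
    IsPsi R S T ↔ T.Tau (SimpleClass.mk V) := by
  have := hA.isArtinianRing
  have := IsSimpleModule.nontrivial A S.rep
  have key : ∀ (E : ModuleCat.{u} A) (j : S.rep →ₗ[A] E), IsInjectiveEnvelope j →
      (IsTauTilde R (A := A) T.rep (Top A E) ↔ T.Tau (SimpleClass.mk V)) := by
    intro E j hj
    obtain ⟨hEf, hE⟩ := hA.of_isInjectiveEnvelope hj
    have : Nontrivial E := hj.2.1.nontrivial
    have := hE.isSimpleModule_top
    obtain ⟨e, -⟩ := hj.exists_equiv hi
    rw [hA.isTauTilde_iff, mk_rep, mk_eq_mk_iff.2 (hE.equiv_of_quotients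
      (Submodule.mkQ_surjective (Module.jacobson A E)) (q := v ∘ₗ e.toLinearMap)
      (hv.comp e.surjective))]
  exact ⟨fun ⟨E, j, hj, h⟩ => (key E j hj).1 h,
    fun h => ⟨ModuleCat.of A I, i, hi, (key _ i hi).2 h⟩⟩

theorem IsConnectedNakayama.existsUnique_isGamma (hA : IsConnectedNakayama R A)
    (S : SimpleClass A) : ∃! T : SimpleClass A, IsGamma R S T := by
  have := hA.isArtinianRing
  have := IsSimpleModule.nontrivial A S.rep
  obtain ⟨P, p, hf, hP, hp⟩ := hA.exists_projective S.rep
  have : Nontrivial P := hp.2.1.nontrivial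
  have := hP.isSimpleModule_socle
  simp_rw [hA.isGamma_iff hp (socle A P).injective_subtype]
  exact hA.existsUnique_tau_right _

theorem IsConnectedNakayama.existsUnique_isPsi (hA : IsConnectedNakayama R A)
    (S : SimpleClass A) : ∃! T : SimpleClass A, IsPsi R S T := by
  have := hA.isArtinianRing
  have := IsSimpleModule.nontrivial A S.rep
  obtain ⟨I, i, hf, hI, hi⟩ := hA.exists_injective S.rep
  have : Nontrivial I := hi.2.1.nontrivial
  have := hI.isSimpleModule_top
  simp_rw [hA.isPsi_iff hi (Submodule.mkQ_surjective (Module.jacobson A I))]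
  exact hA.existsUnique_tau_left _

theorem IsConnectedNakayama.isGamma_gamma (hA : IsConnectedNakayama R A) (S : SimpleClass A) :
    IsGamma R S (gamma R S) :=
  Classical.epsilon_spec_aux ⟨S⟩ (IsGamma R S) (hA.existsUnique_isGamma S).exists

theorem IsConnectedNakayama.isPsi_psi (hA : IsConnectedNakayama R A) (S : SimpleClass A) :
    IsPsi R S (psi R S) :=
  Classical.epsilon_spec_aux ⟨S⟩ (IsPsi R S) (hA.existsUnique_isPsi S).exists

open CategoryTheory in
-- Dimension shifting along 0 → ker p → P → S → 0 handles the bound ≤ 1, while the bound ≥ 1 says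
-- that `S` is not projective.
theorem projectiveDimension_eq_one_iff [Module.Projective A P] {p : P →ₗ[A] S.rep}
    (hp : Function.Surjective p) : projectiveDimension S.rep = 1 ↔
      ¬ Module.Projective A S.rep ∧ Module.Projective A (LinearMap.ker p) := by
  have hse := LinearMap.shortExact_shortComplexKer hp
  have hproj : Projective (ModuleCat.of A P) := (IsProjective.iff_projective P).1 ‹_›
  have h2 := hse.hasProjectiveDimensionLT_X₃_iff 0 hproj
  have h1 : (1 : WithBot ℕ∞) = ((1 : ℕ) : WithBot ℕ∞) := rfl
  rw [le_antisymm_iff, h1, projectiveDimension_le_iff, projectiveDimension_ge_iff, and_comm]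
  refine and_congr (not_congr ?_) (h2.trans ?_)
  · rw [← projective_iff_hasProjectiveDimensionLT_one, IsProjective.iff_projective]
  · rw [zero_add, ← projective_iff_hasProjectiveDimensionLT_one, IsProjective.iff_projective]

/-- A simple module in the image of `ψ` does not have projective dimension `1`. -/
theorem IsConnectedNakayama.isBlack_of_isPsi (hA : IsConnectedNakayama R A)
    (h : IsPsi R T S) : IsBlack S := by
  have := hA.isArtinianRing
  intro hpd
  obtain ⟨P, p, hPf, hP, hp⟩ := hA.exists_projective S.rep
  have := hp.1
  rw [projectiveDimension_eq_one_iff hp.2.1] at hpd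
  obtain ⟨hS, hK⟩ := hpd
  have := IsSimpleModule.nontrivial A T.rep
  obtain ⟨I, i, hIf, hI, hi⟩ := hA.exists_injective T.rep
  have := hi.1
  have : Nontrivial I := hi.2.1.nontrivial
  have := hI.isSimpleModule_top
  rw [hA.isPsi_iff hi (Submodule.mkQ_surjective (Module.jacobson A I))] at h
  rcases h with ⟨-, hext⟩ | ⟨h, -⟩
  swap
  · exact hS h
  rw [← mk_rep S, ext_mk_iff] at hext
  obtain ⟨b, hb⟩ := hext.exists_surjective_ker hp.2.1
  -- This is where projectivity of the syzygy enters: its map to the top of `I` lifts to `I`, onto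
  -- since `I` is uniserial.
  obtain ⟨k, hk⟩ := Module.projective_lifting_property (Module.jacobson A I).mkQ b
    (Submodule.mkQ_surjective _)
  have hks : Function.Surjective k := by
    refine hI.surjective_of_comp_ne_zero (Submodule.mkQ_surjective (Module.jacobson A I)) ?_
    rw [hk]
    rintro rfl
    have := IsSimpleModule.nontrivial A (Top A I)
    obtain ⟨x, hx⟩ := exists_ne (0 : Top A I)
    obtain ⟨y, rfl⟩ := hb x
    exact hx rfl
  obtain ⟨g, hg⟩ := Module.Injective.exists_extension (LinearMap.ker p).subtype
    (LinearMap.ker p).injective_subtype k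
  have hgk : ∀ y : LinearMap.ker p, g y = k y := fun y => LinearMap.congr_fun hg y
  have hker : LinearMap.ker g ≤ LinearMap.ker p := by
    refine hP.le_ker hp.2.1 fun h => ?_
    obtain ⟨x, hx⟩ := exists_ne (0 : I)
    obtain ⟨y, rfl⟩ := hks x
    apply hx
    rw [← hgk, LinearMap.ker_eq_top.1 h, LinearMap.zero_apply]
  have := IsSimpleModule.nontrivial A S.rep
  obtain ⟨s, hs⟩ := exists_ne (0 : S.rep)
  obtain ⟨x, rfl⟩ := hp.2.1 s
  -- An element `x` outside `ker p` has the same image under `g` as some `y` in `ker p`. Then x − y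
  -- lies in `ker g` ⊆ `ker p`, a contradiction.
  obtain ⟨y, hy⟩ := hks (g x)
  have hxy : x - y ∈ LinearMap.ker g := by
    rw [LinearMap.mem_ker, map_sub, hgk, hy, sub_self]
  have hxy' := hker hxy
  rw [LinearMap.mem_ker, map_sub, y.2, sub_zero] at hxy'
  exact hs hxy'

/-- If the projective dimension of a simple module `S` is not `1`, then `ψ (γ S) = S`. -/
theorem IsConnectedNakayama.isPsi_of_isBlack (hA : IsConnectedNakayama R A) (hS : IsBlack S)
    (h : IsGamma R S T) : IsPsi R T S := by
  have := hA.isArtinianRing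
  have := IsSimpleModule.nontrivial A S.rep
  by_cases hproj : Module.Projective A S.rep
  · have hid : IsProjectiveCover (LinearMap.id : S.rep →ₗ[A] S.rep) :=
      IsSimpleModule.isUniserial.isProjectiveCover Function.surjective_id
    rw [hA.isGamma_iff hid (l := (LinearMap.id : S.rep →ₗ[A] S.rep)) Function.injective_id,
      mk_rep] at h
    rcases h with ⟨h, -⟩ | ⟨-, hT⟩
    · exact absurd hproj h
    have hid' : IsInjectiveEnvelope (LinearMap.id : T.rep →ₗ[A] T.rep) :=
      IsSimpleModule.isUniserial.isInjectiveEnvelope Function.injective_id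
    rw [hA.isPsi_iff hid' (v := (LinearMap.id : T.rep →ₗ[A] T.rep)) Function.surjective_id,
      mk_rep]
    exact Or.inr ⟨hproj, hT⟩
  obtain ⟨P, p, hPf, hP, hp⟩ := hA.exists_projective S.rep
  have := hp.1
  have hKproj : ¬ Module.Projective A (LinearMap.ker p) := fun hK =>
    hS ((projectiveDimension_eq_one_iff hp.2.1).2 ⟨hproj, hK⟩)
  have hKu : IsUniserial A (LinearMap.ker p) := hP.of_injective _ (LinearMap.ker p).injective_subtype
  have hKnt : Nontrivial (LinearMap.ker p) := by
    rw [← not_subsingleton_iff_nontrivial]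
    intro _
    exact hKproj inferInstance
  -- the top `U` of the syzygy of `S`
  obtain ⟨U, hU, hSU⟩ := hA.exists_right hproj
  have := IsSimpleModule.nontrivial A U
  obtain ⟨b, hb⟩ := hSU.exists_surjective_ker hp.2.1
  obtain ⟨P₁, c, hP₁f, hP₁, hc⟩ := hA.exists_projective U
  have := hc.1
  obtain ⟨q, hq⟩ := Module.projective_lifting_property b c hb
  have hqs : Function.Surjective q := by
    refine hKu.surjective_of_comp_ne_zero hb ?_
    rw [hq]
    rintro rfl
    obtain ⟨u, hu⟩ := exists_ne (0 : U)
    obtain ⟨x, rfl⟩ := hc.2.1 u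
    exact hu rfl
  -- the second syzygy and its top `V`
  have hXu : IsUniserial A (LinearMap.ker q) :=
    hP₁.of_injective _ (LinearMap.ker q).injective_subtype
  have hXnt : Nontrivial (LinearMap.ker q) := by
    rw [Submodule.nontrivial_iff_ne_bot]
    exact fun h => hKproj (Module.Projective.of_equiv
      (LinearEquiv.ofBijective q ⟨LinearMap.ker_eq_bot.1 h, hqs⟩))
  have hV := hXu.isSimpleModule_top
  have hVnt := IsSimpleModule.nontrivial A (Top A (LinearMap.ker q))
  let t : LinearMap.ker q →ₗ[A] Top A (LinearMap.ker q) := Submodule.mkQ _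
  have ht : Function.Surjective t := Submodule.mkQ_surjective _
  have hL := hKu.isSimpleModule_socle
  have hLnt := IsSimpleModule.nontrivial A (socle A (LinearMap.ker p))
  have hLV : HasNonsplitExtension (A := A) (socle A (LinearMap.ker p))
      (Top A (LinearMap.ker q)) := by
    -- The preimage of the socle of the syzygy has the second syzygy as its maximal submodule, so
    -- socle and `V` are consecutive factors of P₁.
    let W : Submodule A P₁ := (socle A (LinearMap.ker p)).comap q
    have hXW : LinearMap.ker q ≤ W := LinearMap.ker_le_comap q
    let r : W →ₗ[A] socle A (LinearMap.ker p) := q.restrict fun x hx => hx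
    have hr : Function.Surjective r := by
      rintro ⟨y, hy⟩
      obtain ⟨x, rfl⟩ := hqs y
      exact ⟨⟨x, hy⟩, rfl⟩
    refine (hP₁.of_injective _ W.injective_subtype).hasNonsplitExtension hr
      (Submodule.inclusion_injective hXW) ?_ ht
    ext x
    rw [Submodule.range_inclusion, Submodule.mem_comap, LinearMap.mem_ker, LinearMap.mem_ker]
    exact (Subtype.ext_iff (a1 := r x) (a2 := 0)).symm
  have hTV : T = SimpleClass.mk (Top A (LinearMap.ker q)) := by
    rw [hA.isGamma_iff hp (l := (LinearMap.ker p).subtype ∘ₗ (socle A (LinearMap.ker p)).subtype)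
      ((LinearMap.ker p).injective_subtype.comp (Submodule.injective_subtype _))] at h
    rcases h with ⟨-, h⟩ | ⟨h, -⟩
    · exact h.eq_right hA (ext_mk_iff.2 hLV)
    · exact absurd (SimpleClass.projective_rep_mk_iff.1 h) hLV.not_projective
  obtain ⟨eT⟩ : Nonempty (T.rep ≃ₗ[A] Top A (LinearMap.ker q)) := by
    rw [hTV]
    exact nonempty_rep_mk_equiv
  -- the quotient `Y` of `P₁` with socle `V` is the injective envelope of `V`
  let K' : Submodule A P₁ := (LinearMap.ker t).map (LinearMap.ker q).subtype
  obtain ⟨ι, hι, hιt⟩ := exists_quotient_embedding (LinearMap.ker q).injective_subtype ht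
    (K := K') rfl
  have hK'q : K' ≤ LinearMap.ker q := Submodule.map_subtype_le _ _
  have hK'c : K' ≤ LinearMap.ker c := by
    refine hP₁.le_ker hc.2.1 fun h => ?_
    obtain ⟨x, hx⟩ := exists_ne (0 : LinearMap.ker p)
    obtain ⟨y, rfl⟩ := hqs x
    exact hx (hK'q (h ▸ Submodule.mem_top : y ∈ K'))
  have hY : IsUniserial A (P₁ ⧸ K') := hP₁.of_surjective K'.mkQ K'.mkQ_surjective
  let c' : (P₁ ⧸ K') →ₗ[A] U := K'.liftQ c hK'c
  have hc' : Function.Surjective c' := fun u => by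
    obtain ⟨x, rfl⟩ := hc.2.1 u
    exact ⟨K'.mkQ x, rfl⟩
  let q' : (P₁ ⧸ K') →ₗ[A] LinearMap.ker p := K'.liftQ q hK'q
  have hq' : Function.Surjective q' := fun y => by
    obtain ⟨x, rfl⟩ := hqs y
    exact ⟨K'.mkQ x, rfl⟩
  have hq'i : ¬ Function.Injective q' := by
    intro hinj
    obtain ⟨v, hv⟩ := exists_ne (0 : Top A (LinearMap.ker q))
    obtain ⟨x, rfl⟩ := ht v
    apply hv
    apply hι
    apply hinj
    rw [hιt, map_zero, map_zero]
    exact x.2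
  obtain ⟨I, i, hIf, hI, hi⟩ := hA.exists_injective T.rep
  have := hi.1
  have hιT : Function.Injective (ι ∘ₗ eT.toLinearMap) := hι.comp eT.injective
  obtain ⟨j, hj⟩ := Module.Injective.exists_extension _ hιT i
  have hji : Function.Injective j := by
    refine hY.injective_of_comp_ne_zero hιT ?_
    rw [hj]
    rintro rfl
    have := IsSimpleModule.nontrivial A T.rep
    obtain ⟨x, hx⟩ := exists_ne (0 : T.rep)
    exact hx (hi.2.1 rfl)
  let j' := LinearEquiv.ofInjective j hji
  -- Otherwise the factor of `I` just above `Y` is `S`, so `ker p` maps onto `Y` and then, by `q'`,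
  -- onto itself. A surjective endomorphism is injective here, but `q'` kills `V`.
  have hjs : LinearMap.range j = ⊤ := by
    by_contra hne
    obtain ⟨W, hW, -, hs, hext⟩ := exists_next_factor hI hne
      (b := c' ∘ₗ j'.symm.toLinearMap) (hc'.comp j'.symm.surjective)
    obtain ⟨e⟩ := hA.equiv_left hSU hext
    obtain ⟨w, hw⟩ := exists_surjective_ker_of_equiv hp.2.1 hI hW e
    have hinj : Function.Injective (q' ∘ₗ j'.symm.toLinearMap ∘ₗ w) :=
      IsNoetherian.injective_of_surjective_endomorphism _
        (hq'.comp (j'.symm.surjective.comp hw))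
    refine hq'i fun x y hxy => ?_
    obtain ⟨x', hx'⟩ := hw (j' x)
    obtain ⟨y', hy'⟩ := hw (j' y)
    have hx'' : j'.symm (w x') = x := by rw [hx', LinearEquiv.symm_apply_apply]
    have hy'' : j'.symm (w y') = y := by rw [hy', LinearEquiv.symm_apply_apply]
    have : x' = y' := hinj (by
      change q' (j'.symm (w x')) = q' (j'.symm (w y'))
      rw [hx'', hy'', hxy])
    rw [← hx'', ← hy'', this]
  let j'' := LinearEquiv.ofBijective j ⟨hji, LinearMap.range_eq_top.1 hjs⟩
  rw [hA.isPsi_iff hi (v := c' ∘ₗ j''.symm.toLinearMap) (hc'.comp j''.symm.surjective)]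
  refine Or.inl ⟨hproj, ?_⟩
  rw [← mk_rep S]
  exact ext_mk_iff.2 hSU

end Maps

/-! ### Cycles of a self-map -/

section Cycles

variable {α : Type*}

theorem iterate_eq_of_isChain {f : α → α} {l : List α} {a b : α}
    (h : List.IsChain (fun x y => f x = y) (a :: (l ++ [b]))) : f^[l.length + 1] a = b := by
  induction l generalizing a with
  | nil => simpa using h
  | cons c l ih =>
    rw [List.cons_append, List.isChain_cons_cons] at h
    rw [List.length_cons, Function.iterate_succ_apply, h.1]
    exact ih h.2

theorem IsCycleOf.exists_iterate_eq {f : α → α} {C : Cycle α} (hC : IsCycleOf f C) {a : α}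
    (ha : a ∈ C) : ∃ m : ℕ, 0 < m ∧ f^[m] a = a := by
  induction C using Quotient.inductionOn' with
  | h l =>
    -- Rotate the cycle to start at `a`; its closing arrow then returns to `a`.
    obtain ⟨l₁, l₂, rfl⟩ := List.append_of_mem (Cycle.mem_coe_iff.1 ha)
    have hrot : ((l₁ ++ a :: l₂ : List α) : Cycle α) = ((a :: (l₂ ++ l₁) : List α) : Cycle α) :=
      Cycle.coe_eq_coe.2 (by simpa using List.isRotated_append (l := l₁) (l' := a :: l₂))
    have h : Cycle.Chain (fun x y => f x = y) ((l₁ ++ a :: l₂ : List α) : Cycle α) := hC.2.2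
    rw [hrot, Cycle.chain_coe_cons] at h
    exact ⟨_, Nat.succ_pos _, iterate_eq_of_isChain h⟩

/-- A cycle of `f` on which `g` is a left inverse of `f` is, reversed, a cycle of `g`. -/
theorem IsCycleOf.reverse {f g : α → α} {C : Cycle α} (hC : IsCycleOf f C)
    (hg : ∀ a ∈ C, g (f a) = a) : IsCycleOf g C.reverse := by
  obtain ⟨hne, hnd, hch⟩ := hC
  refine ⟨fun h => hne ?_, Cycle.nodup_reverse_iff.2 hnd, ?_⟩
  · rw [← Cycle.reverse_reverse C, h, Cycle.reverse_nil]
  induction C using Cycle.induction_on with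
  | nil => exact Cycle.Chain.nil _
  | cons a l _ =>
    rw [Cycle.chain_coe_cons] at hch
    rw [Cycle.reverse_coe, List.reverse_cons, ← Cycle.coe_cons_eq_coe_append,
      Cycle.chain_coe_cons]
    have : a :: (l.reverse ++ [a]) = (a :: (l ++ [a])).reverse := by simp
    rw [this, List.isChain_reverse]
    refine hch.imp_of_mem_imp fun x y hx _ hxy => ?_
    have hx' : x ∈ ((a :: l : List α) : Cycle α) := by
      rw [Cycle.mem_coe_iff]
      simpa [or_comm, or_assoc] using hx
    change g y = x
    rw [← hxy, hg x hx']

end Cycles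

end NakayamaResolution

-- Since `gamma` and `psi` are picked by choice, the two uniqueness clauses are what make them the
-- intended maps.
open NakayamaResolution in
theorem mainTheorem6 {R A : Type u} [CommRing R] [Ring A] [Algebra R A]
    (hA : IsConnectedNakayama R A) :
    (∀ S : SimpleClass A, ∃! T : SimpleClass A, IsGamma R S T) ∧
    (∀ S : SimpleClass A, ∃! T : SimpleClass A, IsPsi R S T) ∧
    ∀ C : Cycle (SimpleClass A), IsCycleOf (gamma R) C →
      List.TFAE [
        ∃ D : Cycle (SimpleClass A), IsCycleOf (psi R) D ∧ ∀ S, S ∈ D ↔ S ∈ C,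
        ∀ S ∈ C, ∃ m : ℕ, 0 < m ∧ (psi R)^[m] S = S,
        ∀ S ∈ C, IsBlack S] := by
  refine ⟨hA.existsUnique_isGamma, hA.existsUnique_isPsi, fun C hC => ?_⟩
  tfae_have 1 → 2 := fun ⟨D, hD, h⟩ S hS => hD.exists_iterate_eq ((h S).2 hS)
  tfae_have 2 → 3 := fun h S hS => by
    obtain ⟨m, hm, hmS⟩ := h S hS
    -- Positivity of the period exhibits `S` as a value of `ψ`.
    obtain ⟨m, rfl⟩ := Nat.exists_eq_succ_of_ne_zero hm.ne'
    rw [Function.iterate_succ_apply'] at hmS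
    rw [← hmS]
    exact hA.isBlack_of_isPsi (hA.isPsi_psi _)
  tfae_have 3 → 1 := fun h =>
    ⟨C.reverse, hC.reverse fun S hS => (hA.existsUnique_isPsi _).unique (hA.isPsi_psi _)
      (hA.isPsi_of_isBlack (h S hS) (hA.isGamma_gamma S)), fun S => Cycle.mem_reverse_iff⟩
  tfae_finish
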